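/- Let $n\ge 0$ and $l_0,\dots,l_n\ge 1$ be integers. Let $u_{ik}$ ($0\le i\le n$, $0\le k\le l_i$) and $y_1,\dots,y_n$ be (ordinary) differential indeterminates over $\mathbb Q$; write $\mathbf u=(u_{ik})$ and $\mathbf y=(y_j)$. Let $\mathbb Q\{\mathbf y,\mathbf y^{-1};\mathbf u\}$ be the differential ring of Laurent differential polynomials, obtained from the differential polynomial ring $\mathbb Q\{\mathbf u,\mathbf y\}$ by inverting all the derivatives $y_j^{(r)}$, $r\ge 0$. For each $i$ let $M_{i0},\dots,M_{il_i}$ be pairwise distinct Laurent differential monomials $M_{ik}=\prod_{j,r}(y_j^{(r)})^{\alpha_{ikjr}}$ (finitely many nonzero exponents $\alpha_{ikjr}\in\mathbb Z$), and put $$P_i=\sum_{k=0}^{l_i}u_{ik}M_{ik}\qquad(i=0,\dots,n).$$ Let $t_{ikjr}=\alpha_{ikjr}-\alpha_{i0jr}$, let $x_1,\dots,x_n$ be algebraic indeterminates, and let the symbolic support matrix $M_P$ of the system be the $(n+1)\times n$ matrix with entries $d_{ij}=\sum_{k=0}^{l_i}u_{ik}\sum_{r}t_{ikjr}x_j^{\,r}$.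 Similarly, for $1\le k_i\le l_i$, let $M_{k_0,\dots,k_n}$ be the $(n+1)\times n$ matrix with entries $\sum_r t_{ik_ijr}x_j^{\,r}$, the symbolic support matrix of the monomials $M_{0k_0}/M_{00},\dots,M_{nk_n}/M_{n0}$. Ranks are taken over the field of fractions of the ring of the entries. Let $[P_0,\dots,P_n]$ be the differential ideal generated by the $P_i$ in $\mathbb Q\{\mathbf y,\mathbf y^{-1};\mathbf u\}$. The codimension of a prime differential ideal $I$ (assumed proper) of $\mathbb Q\{\mathbf u\}$ is $\sum_i(l_i+1)$ minus the differential transcendence degree over $\mathbb Q$ of the field of fractions of $\mathbb Q\{\mathbf u\}/I$. Then: 1. The differential transcendence degree of $\mathbb Q\langle\mathbf u\rangle\langle P_0/M_{00},\dots,P_n/M_{n0}\rangle$ over $\mathbb Q\langle\mathbf u\rangle$ equals $\operatorname{rank}(M_P)$. 2. $[P_0,\dots,P_n]\cap\mathbb Q\{\mathbf u\}$ is a prime differential ideal of codimension $n+1-\operatorname{rank}(M_P)$. Call $P_0,\dots,P_n$ a Laurent differentially essential system if this ideal is a prime differential ideal of codimension one. Then $P_0,\dots,P_n$ is a Laurent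 differentially essential system if and only if $\operatorname{rank}(M_P)=n$. 3. $P_0,\dots,P_n$ is a Laurent differentially essential system if and only if there exist $k_i$ with $1\le k_i\le l_i$ such that $\operatorname{rank}(M_{k_0,\dots,k_n})=n$. Moreover, this holds if and only if there exist $k_i$ with $1\le k_i\le l_i$ such that the differential transcendence degree of $\mathbb Q\langle M_{0k_0}/M_{00},\dots,M_{nk_n}/M_{n0}\rangle$ over $\mathbb Q$ equals $n$. -/

import Mathlib

open scoped Differential

/-! ### Differential rings: localizations, quotients, ideals -/

/-- A differential ring structure from an additive map satisfying the Leibniz rule. -/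
abbrev differentialOfAddHom {B : Type*} [CommRing B] (f : B →+ B)
    (h : ∀ a b, f (a * b) = a * f b + b * f a) : Differential B where
  deriv := Derivation.mk' f.toIntLinearMap h

/-- The derivation of a differential ring `A` extended to a localization, as the ring
homomorphism `a / m ↦ a / m + (a / m)′ ε` into the dual numbers. -/
noncomputable def localizationDual {A : Type*} [CommRing A] [Differential A] (M : Submonoid A) :
    Localization M →+* TrivSqZeroExt (Localization M) (Localization M) :=
  IsLocalization.lift (M := M)
    (g :=
      { toFun := fun a => TrivSqZeroExt.inl (algebraMap A (Localization M) a) +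
          TrivSqZeroExt.inr (algebraMap A (Localization M) a′)
        map_one' := by ext <;> simp
        map_zero' := by ext <;> simp
        map_add' := fun a b => by ext <;> simp [Algebra.smul_def]
        map_mul' := fun a b => by
          ext <;> simp only [TrivSqZeroExt.fst_add, TrivSqZeroExt.snd_add,
            TrivSqZeroExt.fst_inl, TrivSqZeroExt.snd_inl, TrivSqZeroExt.fst_inr,
            TrivSqZeroExt.snd_inr, TrivSqZeroExt.fst_mul, TrivSqZeroExt.snd_mul,
            map_mul, map_add, Derivation.leibniz, smul_eq_mul, MulOpposite.smul_eq_mul_unop,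
            MulOpposite.unop_op] <;> ring } )
    (fun m => by
      rw [TrivSqZeroExt.isUnit_iff_isUnit_fst]
      simpa using IsLocalization.map_units (Localization M) m)

theorem localizationDual_algebraMap {A : Type*} [CommRing A] [Differential A] (M : Submonoid A)
    (a : A) :
    localizationDual M (algebraMap A (Localization M) a) =
      TrivSqZeroExt.inl (algebraMap A (Localization M) a) +
        TrivSqZeroExt.inr (algebraMap A (Localization M) a′) := by
  simp only [localizationDual, IsLocalization.lift_eq]
  rfl

theorem localizationDual_fst {A : Type*} [CommRing A] [Differential A] (M : Submonoid A)
    (x : Localization M) : (localizationDual M x).fst = x := by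
  have h : ((TrivSqZeroExt.fstHom (Localization M) (Localization M)
      (Localization M)).toRingHom.comp (localizationDual M)) = RingHom.id _ := by
    apply IsLocalization.ringHom_ext M
    ext a
    simp [localizationDual_algebraMap]
  exact congrArg (fun f => f x) h

/-- The derivation of a differential ring extends to every localization (by
`algebraMap_deriv_localization` below and the Leibniz rule, the extension is unique). In
particular the field of fractions of a differential domain is a differential field. -/
noncomputable instance instDifferentialLocalization {A : Type*} [CommRing A] [Differential A]
    (M : Submonoid A) : Differential (Localization M) :=
  differentialOfAddHom
    { toFun := fun x => (localizationDual M x).snd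
      map_zero' := by simp
      map_add' := fun a b => by simp }
    (fun a b => by simp [localizationDual_fst, mul_comm])

theorem algebraMap_deriv_localization {A : Type*} [CommRing A] [Differential A] (M : Submonoid A)
    (a : A) : (algebraMap A (Localization M) a)′ = algebraMap A (Localization M) a′ :=
  (congrArg TrivSqZeroExt.snd (localizationDual_algebraMap M a)).trans (by
    simp only [TrivSqZeroExt.snd_add, TrivSqZeroExt.snd_inl, TrivSqZeroExt.snd_inr, zero_add])

/-- A differential ideal: an ideal closed under the derivation. -/
def IsDiffIdeal {A : Type*} [CommRing A] [Differential A] (I : Ideal A) : Prop :=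
  ∀ a ∈ I, a′ ∈ I

/-- `[S]`: the differential ideal generated by `S`. -/
def diffSpan {A : Type*} [CommRing A] [Differential A] (S : Set A) : Ideal A :=
  sInf {I : Ideal A | S ⊆ I ∧ IsDiffIdeal I}

/-- A prime differential ideal (a prime ideal is not the unit ideal). -/
structure IsPrimeDiffIdeal {A : Type*} [CommRing A] [Differential A] (I : Ideal A) : Prop where
  isPrime : I.IsPrime
  isDiffIdeal : IsDiffIdeal I

/-- The derivation induced on the quotient by a differential ideal. -/
noncomputable abbrev quotientDifferential {A : Type*} [CommRing A] [Differential A] (I : Ideal A)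
    (hI : IsDiffIdeal I) : Differential (A ⧸ I) where
  deriv := Derivation.liftOfSurjective (f := Ideal.Quotient.mkₐ ℤ I)
    (Ideal.Quotient.mkₐ_surjective ℤ I) (d := Differential.deriv) (fun x hx => by
      have hx' : x ∈ I := Ideal.Quotient.eq_zero_iff_mem.1 hx
      exact Ideal.Quotient.eq_zero_iff_mem.2 (hI x hx'))

/-! ### Differential fields of characteristic zero -/

/-- `ℚ⟨S⟩`: the smallest differential subfield containing `S`, that is, the subfield generated by
all derivatives of elements of `S`. (For `S = ∅` it is the prime field, `ℚ` in characteristic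
zero.) -/
def diffAdjoin {E : Type*} [Field E] [Differential E] (S : Set E) : Subfield E :=
  Subfield.closure {x : E | ∃ s ∈ S, ∃ k : ℕ, x = (fun a : E => a′)^[k] s}

/-- A set `s` is differentially independent over the subfield `K` if the family of all derivatives
of its elements is algebraically independent over `K`. -/
def DiffIndep {E : Type*} [Field E] [Differential E] (K : Subfield E) (s : Set E) : Prop :=
  AlgebraicIndependent K (fun p : s × ℕ => (fun a : E => a′)^[p.2] (p.1 : E))

/-- The differential transcendence degree of `L` over `K`, for differential subfields `K ≤ L` of a
differential field: the maximal cardinality of a subset of `L` differentially independent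
over `K`. -/
noncomputable def diffTrdeg {E : Type*} [Field E] [Differential E] (K L : Subfield E) : Cardinal :=
  ⨆ s : {s : Set E // s ⊆ L ∧ DiffIndep K s}, Cardinal.mk s.1

/-! ### Differential polynomials over `ℚ` -/

/-- `ℚ{σ}`: differential polynomials over `ℚ`; the variable `(s, k)` is the `k`-th derivative of
the differential indeterminate `s`. -/
abbrev DiffPoly (σ : Type) : Type := MvPolynomial (σ × ℕ) ℚ

noncomputable instance instDifferentialDiffPoly (σ : Type) : Differential (DiffPoly σ) where
  deriv := (MvPolynomial.mkDerivation ℚ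
    (fun p : σ × ℕ => (MvPolynomial.X (p.1, p.2 + 1) : DiffPoly σ))).restrictScalars ℤ

/-- The dimension of a prime differential ideal `I` of `ℚ{σ}`: the differential transcendence
degree over `ℚ` of the differential field `Frac (ℚ{σ} / I)`, which is generated over `ℚ` by the
canonical generic point of `I`, the classes of the indeterminates. -/
noncomputable def diffDim {σ : Type} (I : Ideal (DiffPoly σ)) (hI : IsPrimeDiffIdeal I) :
    Cardinal :=
  haveI : I.IsPrime := hI.isPrime
  letI : Differential (DiffPoly σ ⧸ I) := quotientDifferential I hI.isDiffIdeal
  diffTrdeg (E := FractionRing (DiffPoly σ ⧸ I)) (diffAdjoin ∅) ⊤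

/-- `I` is a prime differential ideal of codimension `c` in `ℚ{σ}`, `σ` finite: its dimension is
`card σ - c`. -/
def IsPrimeDiffIdealOfCodim {σ : Type} [Fintype σ] (I : Ideal (DiffPoly σ)) (c : ℕ) : Prop :=
  ∃ hI : IsPrimeDiffIdeal I, diffDim I hI + (c : Cardinal) = (Fintype.card σ : Cardinal)

/-! ### Laurent differential polynomials -/

/-- The multiplicative set of differential monomials in `y` (the indeterminates indexed by `ι`)
inside `ℚ{u, y}`. -/
noncomputable def yMonomials (υ ι : Type) : Submonoid (DiffPoly (υ ⊕ ι)) :=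
  Submonoid.closure (Set.range fun p : ι × ℕ => MvPolynomial.X (Sum.inr p.1, p.2))

/-- `ℚ{y, y⁻¹; u}`: the ring of Laurent differential polynomials in `y` with coefficients in
`ℚ{u}`; all `y_j^{(l)}` are inverted. -/
abbrev LaurentDiffPoly (υ ι : Type) : Type := Localization (yMonomials υ ι)

theorem yMonomials_le (υ ι : Type) : yMonomials υ ι ≤ nonZeroDivisors (DiffPoly (υ ⊕ ι)) := by
  refine (Submonoid.closure_le).2 ?_
  rintro _ ⟨p, rfl⟩
  exact mem_nonZeroDivisors_of_ne_zero (MvPolynomial.X_ne_zero _)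

instance instIsDomainLaurent (υ ι : Type) : IsDomain (LaurentDiffPoly υ ι) :=
  IsLocalization.isDomain_localization (yMonomials_le υ ι)

/-- The differential field `ℚ⟨u, y⟩`. -/
abbrev LaurentField (υ ι : Type) : Type := FractionRing (LaurentDiffPoly υ ι)

/-- `y_j^{(l)}` as a unit of the Laurent differential polynomial ring, `p = (j, l)`. -/
noncomputable def yUnit (υ : Type) {ι : Type} (p : ι × ℕ) : (LaurentDiffPoly υ ι)ˣ :=
  (IsLocalization.map_units (LaurentDiffPoly υ ι)
    (⟨MvPolynomial.X (Sum.inr p.1, p.2), Submonoid.subset_closure ⟨p, rfl⟩⟩ :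
      yMonomials υ ι)).unit

/-- The Laurent differential monomial `∏ (y_j^{(l)})^{α (j, l)}`. -/
noncomputable def laurentMonomial (υ : Type) {ι : Type} (α : ι × ℕ →₀ ℤ) : LaurentDiffPoly υ ι :=
  ((α.prod fun p e => yUnit υ p ^ e : (LaurentDiffPoly υ ι)ˣ) : LaurentDiffPoly υ ι)

/-- The inclusion `ℚ{u} → ℚ{y, y⁻¹; u}`. -/
noncomputable def coeffInclusion (υ ι : Type) : DiffPoly υ →+* LaurentDiffPoly υ ι :=
  (algebraMap (DiffPoly (υ ⊕ ι)) (LaurentDiffPoly υ ι)).comp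
    (MvPolynomial.rename (fun p : υ × ℕ => ((Sum.inl p.1 : υ ⊕ ι), p.2))).toRingHom

/-! ### Generic Laurent differential polynomials -/

/-- The index set of the coefficients `u_{ik}`, `0 ≤ i ≤ n`, `0 ≤ k ≤ l_i`. -/
abbrev CoeffIdx {n : ℕ} (l : Fin (n + 1) → ℕ) : Type := Σ i : Fin (n + 1), Fin (l i + 1)

/-- `P_i = ∑ k, u_{ik} M_{ik}`, where `M_{ik}` has exponent vector `α i k`. -/
noncomputable def genericLaurent {n : ℕ} {l : Fin (n + 1) → ℕ}
    (α : (i : Fin (n + 1)) → Fin (l i + 1) → (Fin n × ℕ →₀ ℤ)) (i : Fin (n + 1)) :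
    LaurentDiffPoly (CoeffIdx l) (Fin n) :=
  ∑ k : Fin (l i + 1),
    coeffInclusion (CoeffIdx l) (Fin n) (MvPolynomial.X (⟨i, k⟩, 0)) *
      laurentMonomial (CoeffIdx l) (α i k)

/-- The elements `u_{ik}` of `ℚ⟨u, y⟩`. -/
noncomputable def coeffSet {n : ℕ} (l : Fin (n + 1) → ℕ) : Set (LaurentField (CoeffIdx l) (Fin n)) :=
  Set.range fun c : CoeffIdx l =>
    algebraMap (LaurentDiffPoly (CoeffIdx l) (Fin n)) _
      (coeffInclusion (CoeffIdx l) (Fin n) (MvPolynomial.X (c, 0)))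

/-- The elements `P_i / M_{i0}` of `ℚ⟨u, y⟩`. -/
def normalizedSet {n : ℕ} {l : Fin (n + 1) → ℕ}
    (α : (i : Fin (n + 1)) → Fin (l i + 1) → (Fin n × ℕ →₀ ℤ)) :
    Set (LaurentField (CoeffIdx l) (Fin n)) :=
  Set.range fun i : Fin (n + 1) =>
    algebraMap (LaurentDiffPoly (CoeffIdx l) (Fin n)) (LaurentField (CoeffIdx l) (Fin n))
        (genericLaurent α i) /
      algebraMap (LaurentDiffPoly (CoeffIdx l) (Fin n)) (LaurentField (CoeffIdx l) (Fin n))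
        (laurentMonomial (CoeffIdx l) (α i 0))

/-- The elements `M_{i k_i} / M_{i0}` of `ℚ⟨u, y⟩`. -/
def monomialRatioSet {n : ℕ} {l : Fin (n + 1) → ℕ}
    (α : (i : Fin (n + 1)) → Fin (l i + 1) → (Fin n × ℕ →₀ ℤ))
    (k : (i : Fin (n + 1)) → Fin (l i + 1)) : Set (LaurentField (CoeffIdx l) (Fin n)) :=
  Set.range fun i : Fin (n + 1) =>
    algebraMap (LaurentDiffPoly (CoeffIdx l) (Fin n)) (LaurentField (CoeffIdx l) (Fin n))
        (laurentMonomial (CoeffIdx l) (α i (k i))) /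
      algebraMap (LaurentDiffPoly (CoeffIdx l) (Fin n)) (LaurentField (CoeffIdx l) (Fin n))
        (laurentMonomial (CoeffIdx l) (α i 0))

/-- The elimination ideal `[P_0, …, P_n] ∩ ℚ{u}`. -/
noncomputable def eliminationIdeal {n : ℕ} {l : Fin (n + 1) → ℕ}
    (α : (i : Fin (n + 1)) → Fin (l i + 1) → (Fin n × ℕ →₀ ℤ)) : Ideal (DiffPoly (CoeffIdx l)) :=
  Ideal.comap (coeffInclusion (CoeffIdx l) (Fin n)) (diffSpan (Set.range (genericLaurent α)))

/-- Laurent differentially essential system: `[P_0, …, P_n] ∩ ℚ{u}` is a prime differential ideal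
of codimension one. -/
def IsLaurentDiffEssential {n : ℕ} {l : Fin (n + 1) → ℕ}
    (α : (i : Fin (n + 1)) → Fin (l i + 1) → (Fin n × ℕ →₀ ℤ)) : Prop :=
  IsPrimeDiffIdealOfCodim (eliminationIdeal α) 1

/-- Laurent differentially essential system, defined through the monomials: there are `k_i ≠ 0`
such that the `M_{i k_i} / M_{i0}` have differential transcendence degree `n` over `ℚ`. -/
def IsLaurentDiffEssentialMonomials {n : ℕ} {l : Fin (n + 1) → ℕ}
    (α : (i : Fin (n + 1)) → Fin (l i + 1) → (Fin n × ℕ →₀ ℤ)) : Prop :=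
  ∃ k : (i : Fin (n + 1)) → Fin (l i + 1), (∀ i, k i ≠ 0) ∧
    diffTrdeg (diffAdjoin ∅) (diffAdjoin (monomialRatioSet α k)) = n

/-! ### Symbolic support matrices -/

/-- The `j`-th entry `∑_r β (j, r) x_j^r` of the symbolic support vector of the Laurent
differential monomial with exponent vector `β`. -/
noncomputable def symbolicEntry (R : Type) [CommRing R] {n : ℕ} (β : Fin n × ℕ →₀ ℤ) (j : Fin n) :
    MvPolynomial (Fin n) R :=
  β.sum fun p t => if p.1 = j then (t : MvPolynomial (Fin n) R) * MvPolynomial.X j ^ p.2 else 0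

/-- The symbolic support matrix of Laurent differential monomials `B_i` with exponent vectors
`β i`. -/
noncomputable def monomialSupportMatrix {n m : ℕ} (β : Fin m → (Fin n × ℕ →₀ ℤ)) :
    Matrix (Fin m) (Fin n) (MvPolynomial (Fin n) ℤ) :=
  Matrix.of fun i j => symbolicEntry ℤ (β i) j

/-- The symbolic support matrix `M_P` of `P_0, …, P_n`; its `(i, j)` entry is
`∑_k u_{ik} ∑_r t_{ikjr} x_j^r` with `t_{ik} = α_{ik} - α_{i0}`. -/
noncomputable def symbolicSupportMatrix {n : ℕ} {l : Fin (n + 1) → ℕ}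
    (α : (i : Fin (n + 1)) → Fin (l i + 1) → (Fin n × ℕ →₀ ℤ)) :
    Matrix (Fin (n + 1)) (Fin n) (MvPolynomial (Fin n) (DiffPoly (CoeffIdx l))) :=
  Matrix.of fun i j => ∑ k : Fin (l i + 1),
    MvPolynomial.C (MvPolynomial.X (⟨i, k⟩, 0)) *
      symbolicEntry (DiffPoly (CoeffIdx l)) (α i k - α i 0) j

/-- The rank of a matrix over a domain: its rank over the field of fractions. -/
noncomputable def fracRank {R : Type} [CommRing R] [IsDomain R] {m n : ℕ}
    (A : Matrix (Fin m) (Fin n) R) : ℕ :=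
  (A.map (algebraMap R (FractionRing R))).rank

/-!
Let `ρ` be the rank of the symbolic support matrix `M_P`. Everything rests on three differential
transcendence degrees in `ℚ⟨u, y⟩`: that of the normalized polynomials `P_i / M_{i0}` over `ℚ⟨u⟩`,
that of a selection of monomials `M_{i k_i} / M_{i0}` over `ℚ`, and that of the generic zero of the
elimination ideal over `ℚ`. Each is bounded from both sides by a rank.

*Lower bounds.* Varying `y_j` to `y_j (1 + ε_j e ^ (X z))`, `z′ = 1`, gives a derivation `Δ` of
`ℚ⟨u, y⟩` with values in the vectors of polynomials in `X`; it kills `u` and intertwines the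
derivation of the field with `w ↦ w′ + X w`. Elements `f_i` are differentially independent as soon
as the vectors `Δ f_i^{(k)}` are linearly independent (`algebraicIndependent_of_derivation`), and
this may be checked after a specialization: the `u`'s become constants which single out one monomial
in each `f_i`, and `y_j` becomes `q ^ m_j` with `q′ = q`. The logarithmic gradient of a monomial is
then its symbolic support vector, evaluated at `x_j = 1 + X / m_j`
(`algebraicIndependent_of_symbolicEntry`). Finally, independent rows of `M_P` yield independent
symbolic support vectors of one monomial in each row (`exists_selection`).

*Upper bounds.* Every finite family of vectors spanning a space of dimension `r` has a subfamily `I`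
in which each vector lies in the span of the other ones, and whose span has dimension `r` minus
the number of vectors outside `I` (`exists_dependent_subfamily`). For the rows of `M_P`, the
translation `u_{ik} ↦ u_{ik} + 1` then shows that the span of the rows in `I` contains all
symbolic support vectors of their monomials (`exists_row_bound`); for the columns of a symbolic
support matrix, translating `x_j` shows the same for the coefficient vectors
(`exists_monomial_basis`). So, up to few `P_i` and few `y_j`, the monomials are, up to powers, power products
of few of them. Counting the derivatives of bounded order (`card_le_of_diffIndep`) turns this
into a bound on the differential transcendence degree.

*Primality.* Solving `P_i = 0` for `u_{i0}` defines a differential endomorphism of the Laurent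
differential polynomial ring, whose kernel is `[P_0, …, P_n]` (`diffSpan_genericLaurent_eq_ker`).
The elimination ideal is therefore the kernel of a differential homomorphism to a field. Its generic
zero consists of the `u_{ik}`, `k ≠ 0`, which are differentially independent over `ℚ`, and of the
`u_{i0} - P_i / M_{i0}`, which contribute `ρ` by the same two bounds.
-/

/-! ### Differential transcendence degree: upper bounds -/

/-- The relative algebraic closure in `E` of the subfield generated by `K` and `s`. It is the
closure of `s` in the matroid of algebraic independence over `K`. -/
noncomputable def algClosure {E : Type*} [Field E] (K : Subfield E) (s : Set E) : Subfield E where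
  carrier := (AlgebraicIndependent.matroid K E).closure s
  mul_mem' := by
    simp only [AlgebraicIndependent.matroid_closure_eq]
    exact fun ha hb => mul_mem ha hb
  one_mem' := by
    simp only [AlgebraicIndependent.matroid_closure_eq]
    exact one_mem _
  add_mem' := by
    simp only [AlgebraicIndependent.matroid_closure_eq]
    exact fun ha hb => add_mem ha hb
  zero_mem' := by
    simp only [AlgebraicIndependent.matroid_closure_eq]
    exact zero_mem _
  neg_mem' := by
    simp only [AlgebraicIndependent.matroid_closure_eq]
    exact fun ha => neg_mem ha
  inv_mem' := by
    simp only [AlgebraicIndependent.matroid_closure_eq]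
    exact fun x hx => IsAlgebraic.inv (x := x) hx

section algClosure

variable {E : Type*} [Field E] {K : Subfield E} {s t : Set E}

theorem coe_algClosure :
    (algClosure K s : Set E) = (AlgebraicIndependent.matroid K E).closure s := rfl

theorem mem_algClosure_iff {x : E} :
    x ∈ algClosure K s ↔ IsAlgebraic (Algebra.adjoin K s) x := by
  rw [← SetLike.mem_coe, coe_algClosure, AlgebraicIndependent.matroid_closure_eq]
  rfl

theorem subset_algClosure : s ⊆ algClosure K s :=
  (AlgebraicIndependent.matroid K E).subset_closure s

theorem le_algClosure : K ≤ algClosure K s := fun x hx =>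
  mem_algClosure_iff.2 (isAlgebraic_algebraMap (⟨x, (Algebra.adjoin K s).algebraMap_mem ⟨x, hx⟩⟩ :
    Algebra.adjoin K s))

theorem algClosure_le (h : s ⊆ algClosure K t) : algClosure K s ≤ algClosure K t :=
  (AlgebraicIndependent.matroid K E).closure_subset_closure_of_subset_closure h

theorem algClosure_mono (h : s ⊆ t) : algClosure K s ≤ algClosure K t :=
  (AlgebraicIndependent.matroid K E).closure_subset_closure h

/-- The relative algebraic closure is relatively algebraically closed. -/
theorem mem_algClosure_of_isAlgebraic {F : Subfield E} (hF : F ≤ algClosure K s) {x : E}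
    (hx : IsAlgebraic F x) : x ∈ algClosure K s := by
  obtain ⟨p, hp, hpx⟩ := hx
  let i : F →+* Subalgebra.algebraicClosure (Algebra.adjoin K s) E :=
    { toFun := fun a => ⟨a, mem_algClosure_iff.1 (hF a.2)⟩
      map_one' := rfl
      map_mul' := fun _ _ => rfl
      map_zero' := rfl
      map_add' := fun _ _ => rfl }
  have hi : Function.Injective i := fun a b h => by
      have h0 := congrArg Subtype.val h
      exact Subtype.ext h0
  have h1 : IsAlgebraic (Subalgebra.algebraicClosure (Algebra.adjoin K s) E) x := by
    refine ⟨p.map i, (Polynomial.map_ne_zero_iff hi).2 hp, ?_⟩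
    rw [Polynomial.aeval_def, Polynomial.eval₂_map]
    exact hpx
  exact mem_algClosure_iff.2 (IsAlgebraic.restrictScalars (Algebra.adjoin K s) h1)

theorem mem_algClosure_of_pow_mem {x : E} {m : ℕ} (hm : m ≠ 0) (hx : x ^ m ∈ algClosure K s) :
    x ∈ algClosure K s := by
  refine mem_algClosure_of_isAlgebraic le_rfl ⟨Polynomial.X ^ m - Polynomial.C ⟨_, hx⟩,
    Polynomial.X_pow_sub_C_ne_zero (Nat.pos_of_ne_zero hm) _, ?_⟩
  simp only [map_sub, map_pow, Polynomial.aeval_X, Polynomial.aeval_C]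
  exact sub_self _

theorem card_le_of_algebraicIndependent {ι κ : Type*} [Fintype ι] [Fintype κ] {b : ι → E}
    (hb : AlgebraicIndependent K b) (c : κ → E) (h : ∀ i, b i ∈ algClosure K (Set.range c)) :
    Fintype.card ι ≤ Fintype.card κ := by
  have hinj := hb.injective
  have h1 : (AlgebraicIndependent.matroid K E).Indep (Set.range b) :=
    AlgebraicIndependent.matroid_indep_iff.2 hb.to_subtype_range
  have h2 := h1.encard_le_eRk_of_subset (X := (AlgebraicIndependent.matroid K E).closure
    (Set.range c)) (by rintro _ ⟨i, rfl⟩; exact h i)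
  rw [Matroid.eRk_closure_eq] at h2
  have h3 := h2.trans ((AlgebraicIndependent.matroid K E).eRk_le_encard _)
  have h4 : (Set.range c).encard ≤ Fintype.card κ := by
    rw [← Set.image_univ]
    refine (Set.encard_image_le _ _).trans ?_
    simp [Set.encard_univ]
  rw [← Set.image_univ, hinj.encard_image, Set.encard_univ] at h3
  simpa using h3.trans h4

end algClosure

section Derivative

variable {E : Type*} [Field E] [Differential E]

theorem deriv_inv_eq (x : E) : (x⁻¹)′ = -(x⁻¹ ^ 2 * x′) := by
  simpa using Derivation.leibniz_inv (Differential.deriv (R := E)) x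

/-- The elements of a subfield `F` whose derivative lies in `F`. -/
def derivSubfield (F : Subfield E) : Subfield E where
  carrier := {x | x ∈ F ∧ x′ ∈ F}
  mul_mem' := fun {a b} ha hb => ⟨mul_mem ha.1 hb.1, by
    rw [Derivation.leibniz]
    exact add_mem (mul_mem ha.1 hb.2) (mul_mem hb.1 ha.2)⟩
  one_mem' := ⟨one_mem _, by simp⟩
  add_mem' := fun {a b} ha hb => ⟨add_mem ha.1 hb.1, by
    rw [map_add]
    exact add_mem ha.2 hb.2⟩
  zero_mem' := ⟨zero_mem _, by simp⟩
  neg_mem' := fun {a} ha => ⟨neg_mem ha.1, by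
    rw [map_neg]
    exact neg_mem ha.2⟩
  inv_mem' := fun a ha => ⟨inv_mem ha.1, by
    rw [deriv_inv_eq]
    exact neg_mem (mul_mem (pow_mem (inv_mem ha.1) 2) ha.2)⟩

/-- Differentiating the minimal polynomial of an element algebraic over the elements whose
derivatives lie in a relatively algebraically closed field `F` shows that the derivative lies
in `F`. -/
theorem deriv_mem_algClosure [CharZero E] {K : Subfield E} (hK : ∀ x ∈ K, x′ ∈ K)
    {s t : Set E} (hst : s ⊆ algClosure K t) (hst' : ∀ x ∈ s, x′ ∈ algClosure K t) {x : E}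
    (hx : x ∈ algClosure K s) : x′ ∈ algClosure K t := by
  set F := algClosure K t
  -- `x` is algebraic over `B`, and the minimal polynomial may be differentiated inside `F`.
  let B := derivSubfield F
  have hKB : K ≤ B := fun y hy => ⟨le_algClosure hy, le_algClosure (hK y hy)⟩
  have hsB : s ⊆ B := fun y hy => ⟨hst hy, hst' y hy⟩
  have hxB : IsAlgebraic B x := by
    have h0 := mem_algClosure_iff.1 hx
    have hle : ∀ y ∈ Algebra.adjoin K s, y ∈ B := by
      intro y hy
      induction hy using Algebra.adjoin_induction with
      | mem y hy => exact hsB hy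
      | algebraMap r => exact hKB r.2
      | add y z _ _ hy hz => exact add_mem hy hz
      | mul y z _ _ hy hz => exact mul_mem hy hz
    obtain ⟨p, hp, hpx⟩ := h0
    let i : Algebra.adjoin K s →+* B :=
      { toFun := fun a => ⟨a, hle a a.2⟩
        map_one' := rfl
        map_mul' := fun _ _ => rfl
        map_zero' := rfl
        map_add' := fun _ _ => rfl }
    have hi : Function.Injective i := fun a b h => by
      have h0 := congrArg Subtype.val h
      exact Subtype.ext h0
    refine ⟨p.map i, (Polynomial.map_ne_zero_iff hi).2 hp, ?_⟩
    rw [Polynomial.aeval_def, Polynomial.eval₂_map]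
    exact hpx
  have hint := hxB.isIntegral
  set p := minpoly B x with hp
  have hxF : x ∈ F := algClosure_le hst hx
  have key := Differential.deriv_aeval_eq (A := E) x (p.map (algebraMap B E))
  rw [Polynomial.aeval_map_algebraMap, hp, minpoly.aeval, ← hp, map_zero,
    Polynomial.derivative_map, Polynomial.aeval_map_algebraMap] at key
  have hne : Polynomial.aeval x (Polynomial.derivative p) ≠ 0 :=
    (minpoly.irreducible hint).separable.aeval_derivative_ne_zero (minpoly.aeval _ _)
  have h1 : Polynomial.aeval x (Differential.mapCoeffs (p.map (algebraMap B E))) ∈ F := by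
    rw [Polynomial.aeval_eq_sum_range]
    refine sum_mem fun i _ => ?_
    rw [smul_eq_mul, Differential.coeff_mapCoeffs, Polynomial.coeff_map]
    exact mul_mem (p.coeff i).2.2 (pow_mem hxF i)
  have h2 : Polynomial.aeval x (Polynomial.derivative p) ∈ F := by
    rw [Polynomial.aeval_eq_sum_range]
    refine sum_mem fun i _ => ?_
    rw [Algebra.smul_def]
    exact mul_mem ((Polynomial.derivative p).coeff i).2.1 (pow_mem hxF i)
  have h3 : x′ = -(Polynomial.aeval x (Differential.mapCoeffs (p.map (algebraMap B E)))) /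
      Polynomial.aeval x (Polynomial.derivative p) := by
    rw [eq_div_iff hne]
    linear_combination -key
  rw [h3]
  exact div_mem (neg_mem h1) h2

theorem subset_diffAdjoin (S : Set E) : S ⊆ diffAdjoin S := fun s hs =>
  Subfield.subset_closure ⟨s, hs, 0, rfl⟩

theorem iterate_deriv_mem_diffAdjoin {S : Set E} {s : E} (hs : s ∈ S) (k : ℕ) :
    (fun a : E => a′)^[k] s ∈ diffAdjoin S :=
  Subfield.subset_closure ⟨s, hs, k, rfl⟩

theorem deriv_mem_diffAdjoin (S : Set E) {x : E} (hx : x ∈ diffAdjoin S) :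
    x′ ∈ diffAdjoin S := by
  have h : diffAdjoin S ≤ derivSubfield (diffAdjoin S) := by
    refine Subfield.closure_le.2 ?_
    rintro _ ⟨s, hs, k, rfl⟩
    refine ⟨iterate_deriv_mem_diffAdjoin hs k, ?_⟩
    have := iterate_deriv_mem_diffAdjoin hs (k + 1)
    rwa [Function.iterate_succ_apply'] at this
  exact (h hx).2

/-- The derivatives of order at most `N` of the members of a finite family. -/
def derivFamily {d : Type*} (g : d → E) (N : ℕ) : d × Fin (N + 1) → E :=
  fun p => (fun a : E => a′)^[(p.2 : ℕ)] (g p.1)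

theorem derivFamily_range_mono {d : Type*} (g : d → E) {N M : ℕ} (h : N ≤ M) :
    Set.range (derivFamily g N) ⊆ Set.range (derivFamily g M) := by
  rintro _ ⟨⟨i, k⟩, rfl⟩
  exact ⟨⟨i, ⟨k, by omega⟩⟩, rfl⟩

variable {d : Type*} {K : Subfield E}

theorem deriv_mem_algClosure_derivFamily [CharZero E] (hK : ∀ x ∈ K, x′ ∈ K) (g : d → E) {N : ℕ}
    {x : E} (hx : x ∈ algClosure K (Set.range (derivFamily g N))) :
    x′ ∈ algClosure K (Set.range (derivFamily g (N + 1))) := by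
  refine deriv_mem_algClosure hK
    ((derivFamily_range_mono g N.le_succ).trans subset_algClosure) ?_ hx
  rintro _ ⟨⟨i, k⟩, rfl⟩
  refine subset_algClosure ⟨⟨i, ⟨k + 1, by omega⟩⟩, ?_⟩
  exact Function.iterate_succ_apply' _ _ _

theorem iterate_deriv_mem_algClosure_derivFamily [CharZero E] (hK : ∀ x ∈ K, x′ ∈ K) (g : d → E)
    {N : ℕ} {x : E} (hx : x ∈ algClosure K (Set.range (derivFamily g N))) (k : ℕ) :
    (fun a : E => a′)^[k] x ∈ algClosure K (Set.range (derivFamily g (N + k))) := by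
  induction k with
  | zero => exact hx
  | succ k ih =>
    rw [Function.iterate_succ_apply', ← add_assoc]
    exact deriv_mem_algClosure_derivFamily hK g ih

/-- The relative algebraic closure in `E` of the differential field generated over `K` by the
family `g`: the elements algebraic over the field generated by finitely many derivatives. -/
def diffAlgClosure (K : Subfield E) (g : d → E) : Subfield E where
  carrier := {x | ∃ N, x ∈ algClosure K (Set.range (derivFamily g N))}
  mul_mem' := by
    rintro a b ⟨N, ha⟩ ⟨M, hb⟩
    exact ⟨max N M, mul_mem (algClosure_mono (derivFamily_range_mono g (le_max_left _ _)) ha)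
      (algClosure_mono (derivFamily_range_mono g (le_max_right _ _)) hb)⟩
  one_mem' := ⟨0, one_mem _⟩
  add_mem' := by
    rintro a b ⟨N, ha⟩ ⟨M, hb⟩
    exact ⟨max N M, add_mem (algClosure_mono (derivFamily_range_mono g (le_max_left _ _)) ha)
      (algClosure_mono (derivFamily_range_mono g (le_max_right _ _)) hb)⟩
  zero_mem' := ⟨0, zero_mem _⟩
  neg_mem' := by
    rintro a ⟨N, ha⟩
    exact ⟨N, neg_mem ha⟩
  inv_mem' := by
    rintro a ⟨N, ha⟩
    exact ⟨N, inv_mem ha⟩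

theorem le_diffAlgClosure (g : d → E) : K ≤ diffAlgClosure K g :=
  fun _ hx => ⟨0, le_algClosure hx⟩

theorem mem_diffAlgClosure_self (g : d → E) (i : d) : g i ∈ diffAlgClosure K g :=
  ⟨0, subset_algClosure ⟨⟨i, 0⟩, rfl⟩⟩

theorem iterate_deriv_mem_diffAlgClosure [CharZero E] (hK : ∀ x ∈ K, x′ ∈ K) {g : d → E} {x : E}
    (hx : x ∈ diffAlgClosure K g) (k : ℕ) : (fun a : E => a′)^[k] x ∈ diffAlgClosure K g := by
  obtain ⟨N, hN⟩ := hx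
  exact ⟨N + k, iterate_deriv_mem_algClosure_derivFamily hK g hN k⟩

theorem mem_diffAlgClosure_of_pow_mem {g : d → E} {x : E} {m : ℕ} (hm : m ≠ 0)
    (hx : x ^ m ∈ diffAlgClosure K g) : x ∈ diffAlgClosure K g := by
  obtain ⟨N, hN⟩ := hx
  exact ⟨N, mem_algClosure_of_pow_mem hm hN⟩

theorem diffAdjoin_le_diffAlgClosure [CharZero E] (hK : ∀ x ∈ K, x′ ∈ K) {g : d → E} {S : Set E}
    (hS : S ⊆ diffAlgClosure K g) : diffAdjoin S ≤ diffAlgClosure K g := by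
  refine Subfield.closure_le.2 ?_
  rintro _ ⟨s, hs, k, rfl⟩
  exact iterate_deriv_mem_diffAlgClosure hK (hS hs) k

/-- A differentially independent family inside the differential algebraic closure of `d` elements
has at most `d` members: the derivatives of order at most `N` of `e` independent elements are
`e (N + 1)` algebraically independent elements, algebraic over `d (N + C + 1)` elements, where
`C` does not depend on `N`. -/
theorem card_le_of_diffIndep [CharZero E] [Fintype d] (hK : ∀ x ∈ K, x′ ∈ K) (g : d → E)
    {ι : Type*} [Fintype ι] {b : ι → E}
    (hb : AlgebraicIndependent K (fun p : ι × ℕ => (fun a : E => a′)^[p.2] (b p.1)))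
    (hbg : ∀ i, b i ∈ diffAlgClosure K g) : Fintype.card ι ≤ Fintype.card d := by
  choose N hN using hbg
  set C := Finset.univ.sup N with hC
  have hNC : ∀ i, b i ∈ algClosure K (Set.range (derivFamily g C)) := fun i =>
    algClosure_mono (derivFamily_range_mono g (Finset.le_sup (Finset.mem_univ i))) (hN i)
  by_contra! hlt
  have key : ∀ M : ℕ, Fintype.card ι * (M + 1) ≤ Fintype.card d * (C + M + 1) := by
    intro M
    have h1 : AlgebraicIndependent K (fun p : ι × Fin (M + 1) =>
        (fun a : E => a′)^[(p.2 : ℕ)] (b p.1)) :=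
      hb.comp (fun p : ι × Fin (M + 1) => (p.1, (p.2 : ℕ)))
        (fun p q h => by
          simp only [Prod.mk.injEq] at h
          exact Prod.ext h.1 (Fin.ext h.2))
    have h2 := card_le_of_algebraicIndependent h1 (derivFamily g (C + M)) (fun p =>
      algClosure_mono (derivFamily_range_mono g (by omega))
        (iterate_deriv_mem_algClosure_derivFamily hK g (hNC p.1) p.2))
    simpa using h2
  -- If `card ι ≥ card d + 1`, the inequality at `M` reads `M + 1 ≤ card d * C`.
  have h3 := key (Fintype.card d * C)
  nlinarith [Nat.zero_le (Fintype.card d * C)]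

/-- The differential transcendence degree is at most the number of elements over which the larger
field is differentially algebraic. -/
theorem diffTrdeg_le [CharZero E] [Fintype d] (hK : ∀ x ∈ K, x′ ∈ K) (g : d → E) {L : Subfield E}
    (hL : L ≤ diffAlgClosure K g) : diffTrdeg K L ≤ (Fintype.card d : Cardinal) := by
  refine ciSup_le' ?_
  rintro ⟨s, hsL, hs⟩
  by_contra! hlt
  have h1 : ((Fintype.card d + 1 : ℕ) : Cardinal) ≤ Cardinal.mk s := by
    rw [← Cardinal.natCast_add_one_le_iff] at hlt
    exact_mod_cast hlt
  obtain ⟨f⟩ : Nonempty (Fin (Fintype.card d + 1) ↪ s) := by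
    rw [← Cardinal.lift_mk_le']
    simpa using h1
  have h2 := card_le_of_diffIndep (b := fun i => (f i : E)) hK g
    (hs.comp (fun p : Fin (Fintype.card d + 1) × ℕ => (f p.1, p.2))
      (fun p q h => by
        simp only [Prod.mk.injEq] at h
        exact Prod.ext (f.injective h.1) h.2))
    (fun i => hL (hsL (f i).2))
  simp at h2

theorem le_diffTrdeg {L : Subfield E} {ι : Type*} [Fintype ι] {b : ι → E} (hbL : ∀ i, b i ∈ L)
    (hb : AlgebraicIndependent K (fun p : ι × ℕ => (fun a : E => a′)^[p.2] (b p.1))) :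
    (Fintype.card ι : Cardinal) ≤ diffTrdeg K L := by
  have hinj : Function.Injective b := fun i j h =>
    congrArg Prod.fst (hb.injective (a₁ := (i, 0)) (a₂ := (j, 0)) h)
  have hs : DiffIndep K (Set.range b) := by
    let e := Equiv.ofInjective b hinj
    refine (algebraicIndependent_equiv' (Equiv.prodCongr e (Equiv.refl ℕ)) ?_).1 hb
    rfl
  have h1 := le_ciSup (f := fun s : {s : Set E // s ⊆ L ∧ DiffIndep K s} => Cardinal.mk s.1)
    Cardinal.bddAbove_of_small ⟨Set.range b, by rintro _ ⟨i, rfl⟩; exact hbL i, hs⟩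
  refine le_trans ?_ h1
  have h2 := Cardinal.mk_range_eq_of_injective hinj
  rw [Cardinal.mk_fintype ι, Cardinal.lift_natCast, Cardinal.lift_eq_nat_iff] at h2
  exact h2.ge

end Derivative

/-! ### Linear independence under specialization -/

/-- Linearly independent rows over a field have a nonvanishing minor of full size. -/
theorem exists_det_ne_zero_of_linearIndependent {F : Type*} [Field F] {ι β : Type*} [Fintype ι]
    [DecidableEq ι] {w : ι → β → F} (hw : LinearIndependent F w) :
    ∃ e : ι → β, (Matrix.of fun i k => w i (e k)).det ≠ 0 := by
  let c : β → ι → F := fun b i => w i b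
  have htop : Submodule.span F (Set.range c) = ⊤ := by
    by_contra hne
    obtain ⟨f, hf, hfc⟩ := Submodule.exists_le_ker_of_lt_top _ (lt_top_iff_ne_top.2 hne)
    apply hf
    have h0 : ∑ i, f (Pi.single i 1) • w i = 0 := by
      ext b
      have h1 : f (c b) = 0 := hfc (Submodule.subset_span ⟨b, rfl⟩)
      rw [LinearMap.pi_apply_eq_sum_univ] at h1
      simp only [Finset.sum_apply, Pi.smul_apply, smul_eq_mul, Pi.zero_apply]
      rw [← h1]
      refine Finset.sum_congr rfl fun i _ => ?_
      rw [smul_eq_mul, mul_comm]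
      congr 2
      ext j
      simp [Pi.single_apply, eq_comm]
    have h2 := Fintype.linearIndependent_iff.1 hw _ h0
    ext i
    simpa using h2 i
  obtain ⟨κ, a, -, hspan, hli⟩ := exists_linearIndependent' F c
  let B : Module.Basis κ F (ι → F) := Module.Basis.mk hli (by rw [hspan, htop])
  let σ : ι ≃ κ := (Pi.basisFun F ι).indexEquiv B
  refine ⟨a ∘ σ, ?_⟩
  have h3 : LinearIndependent F (Matrix.of fun i k => w i ((a ∘ σ) k)).col :=
    hli.comp σ σ.injective
  exact ((Matrix.isUnit_iff_isUnit_det _).1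
    (Matrix.linearIndependent_cols_iff_isUnit.1 h3)).ne_zero

theorem linearIndependent_of_det_ne_zero {F : Type*} [Field F] {ι β : Type*} [Fintype ι]
    [DecidableEq ι] {w : ι → β → F} {e : ι → β} (h : (Matrix.of fun i k => w i (e k)).det ≠ 0) :
    LinearIndependent F w := by
  have h1 : LinearIndependent F (Matrix.of fun i k => w i (e k)).row :=
    Matrix.linearIndependent_rows_iff_isUnit.2
      ((Matrix.isUnit_iff_isUnit_det _).2 (isUnit_iff_ne_zero.2 h))
  exact LinearIndependent.of_comp (LinearMap.funLeft F F e) h1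

/-- Vectors over `A` which become linearly independent after a ring homomorphism `φ` from `A` to a
field are linearly independent over every field containing `A`: a minor which does not vanish
after applying `φ` does not vanish. -/
theorem linearIndependent_of_specialization {A E F : Type*} [CommRing A] [Field E] [Field F]
    (φ : A →+* F) (ψ : A →+* E) (hψ : Function.Injective ψ) {ι β : Type*} {w : ι → β → A}
    (hw : LinearIndependent F fun i b => φ (w i b)) : LinearIndependent E fun i b => ψ (w i b) := by
  classical
  rw [linearIndependent_iff_finset_linearIndependent]
  intro s
  obtain ⟨e, he⟩ := exists_det_ne_zero_of_linearIndependent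
    (hw.comp (fun i : s => (i : ι)) Subtype.val_injective)
  refine linearIndependent_of_det_ne_zero (e := e) ?_
  have h1 : (Matrix.of fun (i k : s) => w i (e k)).det ≠ 0 := by
    intro h0
    apply he
    have h2 := congrArg φ h0
    rw [RingHom.map_det, map_zero] at h2
    exact h2
  have h3 : ψ (Matrix.of fun (i k : s) => w i (e k)).det ≠ 0 := (map_ne_zero_iff ψ hψ).2 h1
  rw [RingHom.map_det] at h3
  exact h3

/-! ### The Jacobian criterion -/

section Jacobian

variable {E : Type*} [Field E] {N : Type*} [AddCommGroup N] [Module E N]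

/-- The kernel of a derivation of a field. -/
def derivationKer (d : Derivation ℤ E N) : Subfield E where
  carrier := {x | d x = 0}
  mul_mem' := fun {a b} (ha : d a = 0) (hb : d b = 0) => show d (a * b) = 0 by
    rw [Derivation.leibniz, ha, hb, smul_zero, smul_zero, add_zero]
  one_mem' := d.map_one_eq_zero
  add_mem' := fun {a b} (ha : d a = 0) (hb : d b = 0) => show d (a + b) = 0 by
    rw [map_add, ha, hb, add_zero]
  zero_mem' := map_zero d
  neg_mem' := fun {a} (ha : d a = 0) => show d (-a) = 0 by rw [map_neg, ha, neg_zero]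
  inv_mem' := fun a (ha : d a = 0) => show d a⁻¹ = 0 by
    by_cases h : a = 0
    · rw [h, inv_zero, map_zero]
    · have h1 := d.leibniz a a⁻¹
      rw [mul_inv_cancel₀ h, d.map_one_eq_zero, ha, smul_zero, add_zero] at h1
      exact (smul_eq_zero.1 h1.symm).resolve_left h

/-- Elements whose differentials are linearly independent are algebraically independent: all
partial derivatives of a polynomial relation of minimal degree vanish. -/
theorem algebraicIndependent_of_derivation [CharZero E] (d : Derivation ℤ E N) {K : Subfield E}
    (hK : K ≤ derivationKer d) {ι : Type*} {x : ι → E}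
    (hx : LinearIndependent E fun i => d (x i)) : AlgebraicIndependent K x := by
  classical
  -- `g` reads off coordinates with respect to the vectors `d (x i)`.
  obtain ⟨g, hg⟩ := LinearMap.exists_leftInverse_of_injective
    (Finsupp.linearCombination E fun i => d (x i)) (LinearMap.ker_eq_bot.2 hx)
  have hgd : ∀ i j, g (d (x j)) i = if i = j then 1 else 0 := by
    intro i j
    have h := congrArg (fun f => f (Finsupp.single j 1) i) hg
    simp only [LinearMap.comp_apply, Finsupp.linearCombination_single, one_smul,
      LinearMap.id_apply, Finsupp.single_apply] at h
    rw [h]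
    exact if_congr eq_comm rfl rfl
  have chain : ∀ (i : ι) (p : MvPolynomial ι K), g (d (MvPolynomial.aeval x p)) i =
      MvPolynomial.aeval x (MvPolynomial.pderiv i p) := by
    intro i p
    induction p using MvPolynomial.induction_on with
    | C a =>
      have h0 : d (algebraMap K E a) = 0 := hK a.2
      simp [h0]
    | add p q hp hq => simp [hp, hq]
    | mul_X p j hp =>
      rw [map_mul, MvPolynomial.aeval_X, Derivation.leibniz, map_add, map_smul, map_smul,
        Finsupp.add_apply, Finsupp.smul_apply, Finsupp.smul_apply, hp, hgd,
        MvPolynomial.pderiv_mul, map_add, map_mul, map_mul, MvPolynomial.pderiv_X,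
        MvPolynomial.aeval_X, smul_eq_mul, smul_eq_mul]
      by_cases h : i = j
      · subst h
        simp only [if_true, Pi.single_eq_same, map_one]
        ring
      · rw [if_neg h, Pi.single_eq_of_ne (Ne.symm h), map_zero]
        ring
  have main : ∀ (m : ℕ) (p : MvPolynomial ι K), (∀ e ∈ p.support, e.degree < m) →
      MvPolynomial.aeval x p = 0 → p = 0 := by
    intro m
    induction m with
    | zero =>
      intro p hp _
      rw [← MvPolynomial.support_eq_empty, Finset.eq_empty_iff_forall_notMem]
      exact fun e he => absurd (hp e he) (Nat.not_lt_zero _)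
    | succ m ih =>
      intro p hp hpx
      have hpd : ∀ i, MvPolynomial.pderiv i p = 0 := by
        intro i
        refine ih _ (fun e he => ?_) ?_
        · rw [MvPolynomial.mem_support_iff, MvPolynomial.coeff_pderiv] at he
          have h1 := hp (e + Finsupp.single i 1)
            (MvPolynomial.mem_support_iff.2 (left_ne_zero_of_mul he))
          rw [map_add, Finsupp.degree_single] at h1
          omega
        · rw [← chain, hpx, map_zero, map_zero, Finsupp.zero_apply]
      have hC : p = MvPolynomial.C (MvPolynomial.coeff 0 p) := by
        refine MvPolynomial.ext _ _ fun e => ?_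
        rw [MvPolynomial.coeff_C]
        split_ifs with h
        · rw [h]
        · obtain ⟨i, hi⟩ : ∃ i, e i ≠ 0 := by
            by_contra! h0
            exact h (Finsupp.ext fun i => (h0 i).symm)
          have h1 := MvPolynomial.coeff_pderiv (i := i) p (e - Finsupp.single i 1)
          rw [hpd i, MvPolynomial.coeff_zero, tsub_add_cancel_of_le
            (Finsupp.single_le_iff.2 (Nat.one_le_iff_ne_zero.2 hi))] at h1
          have h2 : (((e - Finsupp.single i 1 : ι →₀ ℕ) i : ℕ) : K) + 1 ≠ 0 :=
            Nat.cast_add_one_ne_zero _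
          exact (mul_eq_zero.1 h1.symm).resolve_right h2
      rw [hC, MvPolynomial.aeval_C] at hpx
      rw [hC, (map_eq_zero_iff _ (algebraMap K E).injective).1 hpx, map_zero]
  rw [algebraicIndependent_iff]
  intro p hp
  refine main (p.support.sup Finsupp.degree + 1) p (fun e he => ?_) hp
  exact Nat.lt_succ_of_le (Finset.le_sup (f := Finsupp.degree) he)

end Jacobian

/-! ### Derivations and differential homomorphisms of localizations -/

section Localization

/-- A derivation into a module over a localization extends to the localization, through the ring
homomorphism `a / m ↦ a / m + d (a / m) ε` into the trivial square-zero extension. -/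
theorem exists_derivation_extension {A S N : Type*} [CommRing A] [CommRing S] [Algebra A S]
    (M : Submonoid A) [IsLocalization M S] [AddCommGroup N] [Module S N] (d : A →+ N)
    (hd : ∀ a b, d (a * b) = algebraMap A S a • d b + algebraMap A S b • d a) :
    ∃ D : S →+ N, (∀ a b, D (a * b) = a • D b + b • D a) ∧ ∀ a, D (algebraMap A S a) = d a := by
  -- The trivial square-zero extension requires a right module structure.
  let _ : Module Sᵐᵒᵖ N := Module.compHom N ((RingHom.id S).fromOpposite fun a b => mul_comm a b)
  have hop : ∀ (a : S) (y : N), MulOpposite.op a • y = a • y := fun _ _ => rfl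
  have : IsCentralScalar S N := ⟨hop⟩
  have hd1 : d 1 = 0 := by
    have h := hd 1 1
    rw [mul_one, (algebraMap A S).map_one, one_smul] at h
    exact left_eq_add.1 h
  let g : A →+* TrivSqZeroExt S N :=
    { toFun := fun a => TrivSqZeroExt.inl (algebraMap A S a) + TrivSqZeroExt.inr (d a)
      map_one' := by ext <;> simp [hd1]
      map_zero' := by ext <;> simp
      map_add' := fun a b => by ext <;> simp
      map_mul' := fun a b => by
        ext
        · simp
        · simp only [TrivSqZeroExt.snd_add, TrivSqZeroExt.snd_inl, TrivSqZeroExt.snd_inr,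
            TrivSqZeroExt.snd_mul, TrivSqZeroExt.fst_add, TrivSqZeroExt.fst_inl,
            TrivSqZeroExt.fst_inr, hop, hd, zero_add, add_zero] }
  have hg : ∀ m : M, IsUnit (g m) := fun m => by
    rw [TrivSqZeroExt.isUnit_iff_isUnit_fst]
    simpa [g] using IsLocalization.map_units S m
  let h : S →+* TrivSqZeroExt S N := IsLocalization.lift hg
  have hfst : ∀ x, (h x).fst = x := by
    have h1 : ((TrivSqZeroExt.fstHom S S N).toRingHom.comp h) = RingHom.id _ := by
      apply IsLocalization.ringHom_ext M
      ext a
      simp [h, g]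
    exact fun x => congrArg (fun f => f x) h1
  let D0 : S →+ N :=
    { toFun := fun x => (h x).snd
      map_zero' := by simp
      map_add' := fun a b => by simp }
  refine ⟨D0, fun a b => ?_, fun a => ?_⟩
  · change (h (a * b)).snd = a • (h b).snd + b • (h a).snd
    rw [map_mul, TrivSqZeroExt.snd_mul, hfst, hfst, hop]
  · change (h (algebraMap A S a)).snd = d a
    simp [h, g, IsLocalization.lift_eq]

/-- A ring homomorphism out of a localization commutes with the derivations if it does so on the
original ring. -/
theorem localization_map_deriv {A B : Type*} [CommRing A] [Differential A] (M : Submonoid A)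
    [CommRing B] [Differential B] (f : Localization M →+* B)
    (hf : ∀ a, f (algebraMap A _ a′) = (f (algebraMap A _ a))′) (x : Localization M) :
    f x′ = (f x)′ := by
  obtain ⟨⟨a, m⟩, h⟩ := IsLocalization.surj M x
  simp only at h
  have hu : IsUnit (f (algebraMap A _ (m : A))) := (IsLocalization.map_units _ m).map f
  have h1 := congrArg (fun z => f z′) h
  have h2 := congrArg (fun z => (f z)′) h
  simp only [Derivation.leibniz, smul_eq_mul, map_add, map_mul,
    algebraMap_deriv_localization, hf] at h1 h2
  refine hu.mul_left_cancel ?_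
  linear_combination h1 - h2

end Localization

/-! ### The twisted derivative on polynomial vectors -/

section Twist

section MapVec

variable {R S : Type*} [CommRing R] [CommRing S] {n : ℕ}

/-- Apply a ring homomorphism to all coefficients of a vector of polynomials. -/
noncomputable def mapVec (f : R →+* S) (n : ℕ) :
    (Fin n → Polynomial R) →+ (Fin n → Polynomial S) where
  toFun w j := (w j).map f
  map_zero' := by ext j; simp
  map_add' v w := by funext j; simp

theorem mapVec_apply (f : R →+* S) (w : Fin n → Polynomial R) (j : Fin n) :
    mapVec f n w j = (w j).map f := rfl

theorem mapVec_smul (f : R →+* S) (a : R) (w : Fin n → Polynomial R) :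
    mapVec f n (a • w) = f a • mapVec f n w := by
  funext j
  simp [mapVec_apply, Polynomial.smul_eq_C_mul]

theorem mapVec_single (f : R →+* S) (j : Fin n) (p : Polynomial R) :
    mapVec f n (Pi.single j p) = Pi.single j (p.map f) := by
  funext i
  by_cases h : i = j
  · subst h; simp [mapVec_apply]
  · simp [mapVec_apply, Pi.single_eq_of_ne h]

end MapVec

variable {R S : Type*} [CommRing R] [Differential R] [CommRing S] [Differential S] {n : ℕ}

/-- The operator `w ↦ w′ + X w` on vectors of polynomials, where `w′` differentiates the
coefficients. It describes the derivation on formal vectors `w e ^ (X z)`, for a variable `z` with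
`z′ = 1`. -/
noncomputable def twist (R : Type*) [CommRing R] [Differential R] (n : ℕ) :
    (Fin n → Polynomial R) →+ (Fin n → Polynomial R) where
  toFun w j := Differential.mapCoeffs (w j) + Polynomial.X * w j
  map_zero' := by ext j; simp
  map_add' v w := by
    funext j
    simp only [Pi.add_apply, map_add]
    ring

theorem twist_apply (w : Fin n → Polynomial R) (j : Fin n) :
    twist R n w j = Differential.mapCoeffs (w j) + Polynomial.X * w j := rfl

theorem twist_smul (a : R) (w : Fin n → Polynomial R) :
    twist R n (a • w) = a′ • w + a • twist R n w := by
  funext j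
  simp only [twist_apply, Pi.smul_apply, Pi.add_apply, Polynomial.smul_eq_C_mul,
    Derivation.leibniz, smul_eq_mul, Differential.mapCoeffs_C]
  ring

theorem mapVec_twist {f : R →+* S} (hf : ∀ a, f a′ = (f a)′) (w : Fin n → Polynomial R) :
    mapVec f n (twist R n w) = twist S n (mapVec f n w) := by
  funext j
  ext k
  simp only [mapVec_apply, twist_apply, Polynomial.map_add, Polynomial.map_mul, Polynomial.map_X,
    Polynomial.coeff_add, Polynomial.coeff_map, Differential.coeff_mapCoeffs, hf]

theorem mapVec_iterate_twist {f : R →+* S} (hf : ∀ a, f a′ = (f a)′) (w : Fin n → Polynomial R)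
    (k : ℕ) : mapVec f n ((twist R n)^[k] w) = (twist S n)^[k] (mapVec f n w) := by
  induction k with
  | zero => rfl
  | succ k ih =>
    rw [Function.iterate_succ_apply', Function.iterate_succ_apply', mapVec_twist hf, ih]

/-- On vectors of the form `c w` with `c′ = ω c` and with `w` and `ω` constant, the twisted
derivative is multiplication by `ω + X`. -/
theorem iterate_twist_eq {c : R} {ω : ℤ} (hc : c′ = ω * c) {w : Fin n → Polynomial R}
    (hw : ∀ j, Differential.mapCoeffs (w j) = 0) (k : ℕ) :
    (twist R n)^[k] (c • w) =
      c • (Polynomial.X + Polynomial.C (ω : R)) ^ k • w := by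
  induction k with
  | zero => simp
  | succ k ih =>
    have h0 : Differential.mapCoeffs (Polynomial.X + Polynomial.C (ω : R)) = 0 := by
      simp
    rw [Function.iterate_succ_apply', ih, twist_smul, hc]
    funext j
    simp only [twist_apply, Pi.smul_apply, Pi.add_apply, Polynomial.smul_eq_C_mul, smul_eq_mul,
      Derivation.leibniz, Derivation.leibniz_pow, hw, h0, map_mul]
    ring

end Twist

/-! ### Evaluation of symbolic support vectors -/

section SymbolicEval

variable {R S : Type*} [CommRing R] [CommRing S] {n : ℕ}

/-- The value at the point `a` of the symbolic support vector with exponents `β`. -/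
def symbolicEval (a : Fin n → R) (β : Fin n × ℕ →₀ ℤ) : Fin n → R :=
  fun j => β.sum fun p t => if p.1 = j then (t : R) * a j ^ p.2 else 0

theorem map_symbolicEval (f : R →+* S) (a : Fin n → R) (β : Fin n × ℕ →₀ ℤ) (j : Fin n) :
    f (symbolicEval a β j) = symbolicEval (fun j => f (a j)) β j := by
  simp only [symbolicEval, Finsupp.sum, map_sum]
  refine Finset.sum_congr rfl fun p _ => ?_
  split_ifs <;> simp

theorem symbolicEntry_eq (R : Type) [CommRing R] (β : Fin n × ℕ →₀ ℤ) (j : Fin n) :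
    symbolicEntry R β j = symbolicEval MvPolynomial.X β j := rfl

/-- Symbolic support vectors which are linearly independent over the field of rational functions
are linearly independent at some point with coordinates `1 + 1 / m`, since such points are dense.
-/
theorem exists_symbolicEval_linearIndependent (R : Type) [CommRing R] [IsDomain R]
    {κ : Type*} [Fintype κ] {β : κ → (Fin n × ℕ →₀ ℤ)}
    (h : LinearIndependent (FractionRing (MvPolynomial (Fin n) R)) fun i j =>
      algebraMap (MvPolynomial (Fin n) R) (FractionRing (MvPolynomial (Fin n) R))
        (symbolicEntry R (β i) j)) :
    ∃ m : Fin n → ℕ, (∀ j, 0 < m j) ∧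
      LinearIndependent ℚ fun i => symbolicEval (fun j => 1 + 1 / (m j : ℚ)) (β i) := by
  classical
  obtain ⟨e, he⟩ := exists_det_ne_zero_of_linearIndependent h
  -- The minor has integer coefficients, whatever the ring `R`.
  let M : Matrix κ κ (MvPolynomial (Fin n) ℤ) := Matrix.of fun i k => symbolicEntry ℤ (β i) (e k)
  have hM : M.det ≠ 0 := by
    intro h0
    apply he
    let f : MvPolynomial (Fin n) ℤ →+* FractionRing (MvPolynomial (Fin n) R) :=
      (algebraMap _ _).comp (MvPolynomial.map (algebraMap ℤ R))
    have h1 := congrArg f h0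
    rw [RingHom.map_det, map_zero] at h1
    rw [← h1]
    congr 1
    ext i k
    simp only [M, f, Matrix.of_apply, RingHom.mapMatrix_apply, Matrix.map_apply,
      RingHom.comp_apply, symbolicEntry_eq, map_symbolicEval, MvPolynomial.map_X]
  have hM' : MvPolynomial.map (algebraMap ℤ ℚ) M.det ≠ 0 := by
    rwa [Ne, map_eq_zero_iff _ (MvPolynomial.map_injective _ (RingHom.injective_int _))]
  -- A nonzero polynomial does not vanish on a product of infinite sets.
  let s : Fin n → Set ℚ := fun _ => Set.range fun m : ℕ => 1 + 1 / ((m + 1 : ℕ) : ℚ)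
  have hs : ∀ j, (s j).Infinite := fun j => by
    refine Set.infinite_range_of_injective fun a b hab => ?_
    simp only [add_right_inj, one_div, inv_inj, Nat.cast_inj] at hab
    omega
  obtain ⟨a, ha, haM⟩ : ∃ a ∈ Set.pi Set.univ s,
      MvPolynomial.eval a (MvPolynomial.map (algebraMap ℤ ℚ) M.det) ≠ 0 := by
    by_contra! h0
    exact hM' (MvPolynomial.funext_set s hs fun x hx => by rw [h0 x hx, map_zero])
  choose m hm using fun j => ha j (Set.mem_univ j)
  refine ⟨fun j => m j + 1, fun j => Nat.succ_pos _, linearIndependent_of_det_ne_zero (e := e) ?_⟩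
  let f : MvPolynomial (Fin n) ℤ →+* ℚ :=
    (MvPolynomial.eval a).comp (MvPolynomial.map (algebraMap ℤ ℚ))
  have h2 : f M.det ≠ 0 := haM
  rw [RingHom.map_det] at h2
  have hEq : (Matrix.of fun i k =>
      symbolicEval (fun j => 1 + 1 / ((m j + 1 : ℕ) : ℚ)) (β i) (e k)) = f.mapMatrix M := by
    refine Matrix.ext fun i k => ?_
    simp only [M, f, Matrix.of_apply, RingHom.mapMatrix_apply, Matrix.map_apply,
      RingHom.comp_apply, symbolicEntry_eq, map_symbolicEval, MvPolynomial.map_X,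
      MvPolynomial.eval_X]
    exact congrArg (fun a => symbolicEval a (β i) (e k)) (funext hm)
  rwa [← hEq] at h2

/-- Vectors over a domain which become linearly independent after a ring homomorphism to a field are
linearly independent. -/
theorem linearIndependent_of_specialization' {A F : Type*} [CommRing A] [IsDomain A] [Field F]
    (φ : A →+* F) {ι β : Type*} {w : ι → β → A}
    (hw : LinearIndependent F fun i b => φ (w i b)) : LinearIndependent A w := by
  have h1 := linearIndependent_of_specialization φ (algebraMap A (FractionRing A))
    (IsFractionRing.injective A (FractionRing A)) hw
  have h2 := h1.restrict_scalars (R := A) (fun a b h => by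
    simpa [Algebra.smul_def] using h)
  exact LinearIndependent.of_comp (LinearMap.compLeft (Algebra.linearMap A (FractionRing A)) β) h2

/-- Independence at the specialized point: the twisted derivatives of vectors `c_i p_i`, with
`c_i` exponential and `p_i` constant, are linearly independent if the vectors `p_i` are so at
`X = 1`. -/
theorem linearIndependent_iterate_twist {F : Type*} [Field F] [CharZero F] [Differential F]
    {κ : Type*} {β : κ → (Fin n × ℕ →₀ ℤ)} {m : Fin n → ℕ}
    (hβ : LinearIndependent ℚ fun i => symbolicEval (fun j => 1 + 1 / (m j : ℚ)) (β i))
    {c : κ → F} (hc0 : ∀ i, c i ≠ 0) {ω : κ → ℤ} (hc : ∀ i, (c i)′ = ω i * c i) :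
    LinearIndependent F fun p : κ × ℕ => (twist F n)^[p.2] (c p.1 • symbolicEval
      (fun j => 1 + Polynomial.C (1 / (m j : F)) * Polynomial.X) (β p.1)) := by
  classical
  set w : κ → Fin n → Polynomial F := fun i => symbolicEval
      (fun j => 1 + Polynomial.C (1 / (m j : F)) * Polynomial.X) (β i) with hw
  have hconst : ∀ i j, Differential.mapCoeffs (w i j) = 0 := by
    intro i j
    have hm : ((m j : F)⁻¹)′ = 0 := by
      rw [deriv_inv_eq]
      simp
    have h0 : Differential.mapCoeffs
        ((1 : Polynomial F) + Polynomial.C (1 / (m j : F)) * Polynomial.X) = 0 := by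
      simp [hm]
    simp only [hw, symbolicEval, Finsupp.sum, map_sum]
    refine Finset.sum_eq_zero fun p _ => ?_
    split_ifs
    · rw [Derivation.leibniz, Derivation.leibniz_pow, h0]
      simp
    · simp
  -- The vectors are independent over the polynomial ring, hence so are their products with the
  -- powers of `X + ω_i`, which are independent over the field.
  have hli : LinearIndependent (Polynomial F) w := by
    refine linearIndependent_of_specialization' (Polynomial.evalRingHom 1) ?_
    have h1 := linearIndependent_of_specialization (RingHom.id ℚ) (algebraMap ℚ F)
      (algebraMap ℚ F).injective hβ
    have hEq : (fun i b => Polynomial.evalRingHom 1 (w i b)) = fun i b => algebraMap ℚ F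
        (symbolicEval (fun j => 1 + 1 / (m j : ℚ)) (β i) b) := by
      funext i j
      simp only [hw, map_symbolicEval]
      congr 1
      funext j
      simp
    rw [hEq]
    exact h1
  have hpow : ∀ a : F, LinearIndependent F fun k : ℕ =>
      (Polynomial.X + Polynomial.C a : Polynomial F) ^ k := by
    intro a
    have h1 := (Polynomial.basisMonomials F).linearIndependent.map' (Polynomial.taylor a)
      (LinearMap.ker_eq_bot.2 (Polynomial.taylor_injective a))
    have hEq : (fun k : ℕ => (Polynomial.X + Polynomial.C a : Polynomial F) ^ k) =
        Polynomial.taylor a ∘ Polynomial.basisMonomials F := by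
      funext k
      simp
    rw [hEq]
    exact h1
  rw [linearIndependent_iff']
  intro s g hg p hp
  have h1 : ∑ i ∈ s.image Prod.fst, (∑ p ∈ s with p.1 = i,
      Polynomial.C (g p * c i) * (Polynomial.X + Polynomial.C (ω i : F)) ^ p.2) • w i = 0 := by
    rw [← hg, ← Finset.sum_fiberwise_of_maps_to (g := Prod.fst) (t := s.image Prod.fst)
      (fun p hp => Finset.mem_image_of_mem _ hp)]
    refine Finset.sum_congr rfl fun i _ => ?_
    rw [Finset.sum_smul]
    refine Finset.sum_congr rfl fun p hp => ?_
    obtain rfl := (Finset.mem_filter.1 hp).2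
    rw [iterate_twist_eq (hc p.1) (hconst p.1)]
    funext j
    simp only [Pi.smul_apply, Polynomial.smul_eq_C_mul, smul_eq_mul, map_mul]
    ring
  have h2 := linearIndependent_iff'.1 hli _ _ h1 p.1 (Finset.mem_image_of_mem _ hp)
  have h3 : ∑ k ∈ (s.filter fun q => q.1 = p.1).image Prod.snd,
      (g (p.1, k) * c p.1) • (Polynomial.X + Polynomial.C (ω p.1 : F)) ^ k = 0 := by
    rw [← h2, Finset.sum_image]
    · refine Finset.sum_congr rfl fun q hq => ?_
      have hq1 : (p.1, q.2) = q := Prod.ext (Finset.mem_filter.1 hq).2.symm rfl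
      rw [hq1, Polynomial.smul_eq_C_mul]
    · intro q hq q' hq' h
      exact Prod.ext ((Finset.mem_filter.1 hq).2.trans (Finset.mem_filter.1 hq').2.symm) h
  have h4 := linearIndependent_iff'.1 (hpow (ω p.1)) _ _ h3 p.2
    (Finset.mem_image_of_mem _ (Finset.mem_filter.2 ⟨hp, rfl⟩))
  exact (mul_eq_zero.1 h4).resolve_right (hc0 p.1)

end SymbolicEval

/-! ### Homomorphisms and derivations of Laurent differential polynomials -/

section Laurent

variable {υ ι : Type}

theorem deriv_diffPoly_X {σ : Type} (p : σ × ℕ) :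
    (MvPolynomial.X p : DiffPoly σ)′ = MvPolynomial.X (p.1, p.2 + 1) :=
  MvPolynomial.mkDerivation_X ℚ _ p

theorem deriv_diffPoly_C {σ : Type} (r : ℚ) : (MvPolynomial.C r : DiffPoly σ)′ = 0 :=
  MvPolynomial.derivation_C (MvPolynomial.mkDerivation ℚ
    (fun p : σ × ℕ => (MvPolynomial.X (p.1, p.2 + 1) : DiffPoly σ))) r

/-- The image of a rational number under a ring homomorphism is constant. -/
theorem deriv_ringHom_rat {B : Type*} [CommRing B] [Differential B] (f : ℚ →+* B) (r : ℚ) :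
    (f r)′ = 0 := by
  have hu : IsUnit (f (r.den : ℚ)) :=
    (isUnit_iff_ne_zero.2 (Nat.cast_ne_zero.2 r.den_nz)).map f
  have h1 : f (r.den : ℚ) * f r = f (r.num : ℚ) := by
    rw [← map_mul, mul_comm, Rat.mul_den_eq_num]
  have h2 := congrArg (fun x => x′) h1
  simp only [map_natCast, map_intCast, Derivation.leibniz, Derivation.map_natCast,
    Derivation.map_intCast, smul_eq_mul, mul_zero, add_zero] at h2
  rw [map_natCast] at hu
  exact (hu.mul_right_eq_zero).1 h2

/-- A ring homomorphism on differential polynomials is differential if it is so on the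
indeterminates and their derivatives. -/
theorem diffPoly_map_deriv {σ : Type} {B : Type*} [CommRing B] [Differential B]
    (f : DiffPoly σ →+* B)
    (hf : ∀ p : σ × ℕ, f (MvPolynomial.X (p.1, p.2 + 1)) = (f (MvPolynomial.X p))′)
    (a : DiffPoly σ) : f a′ = (f a)′ := by
  induction a using MvPolynomial.induction_on with
  | C r =>
    rw [deriv_diffPoly_C, map_zero]
    exact (deriv_ringHom_rat (f.comp MvPolynomial.C) r).symm
  | add p q hp hq => simp only [map_add, hp, hq]
  | mul_X p i hp =>
    simp only [Derivation.leibniz, map_add, map_mul, smul_eq_mul, hp, deriv_diffPoly_X, hf]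

theorem iterate_deriv_diffPoly_X {σ : Type} (s : σ) (k : ℕ) :
    (fun a : DiffPoly σ => a′)^[k] (MvPolynomial.X (s, 0)) = MvPolynomial.X (s, k) := by
  induction k with
  | zero => rfl
  | succ k ih => rw [Function.iterate_succ_apply', ih, deriv_diffPoly_X]

theorem map_iterate_deriv {A B : Type*} [CommRing A] [Differential A] [CommRing B]
    [Differential B] {f : A →+* B} (hf : ∀ a, f a′ = (f a)′) (a : A) (k : ℕ) :
    f ((fun a : A => a′)^[k] a) = (fun b : B => b′)^[k] (f a) := by
  induction k with
  | zero => rfl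
  | succ k ih => rw [Function.iterate_succ_apply', Function.iterate_succ_apply', hf, ih]

/-- The `p.2`-th derivative of the indeterminate `p.1` in the Laurent differential polynomial
ring. -/
noncomputable def laurentVar {υ ι : Type} (p : (υ ⊕ ι) × ℕ) : LaurentDiffPoly υ ι :=
  algebraMap (DiffPoly (υ ⊕ ι)) _ (MvPolynomial.X p)

theorem deriv_laurentVar (p : (υ ⊕ ι) × ℕ) :
    (laurentVar p : LaurentDiffPoly υ ι)′ = laurentVar (p.1, p.2 + 1) := by
  rw [laurentVar, algebraMap_deriv_localization, deriv_diffPoly_X, laurentVar]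

theorem coe_yUnit (p : ι × ℕ) :
    (yUnit υ p : LaurentDiffPoly υ ι) = laurentVar (Sum.inr p.1, p.2) := rfl

theorem coeffInclusion_X (p : υ × ℕ) :
    coeffInclusion υ ι (MvPolynomial.X p) = laurentVar (Sum.inl p.1, p.2) := by
  simp [coeffInclusion, laurentVar]

theorem coeffInclusion_deriv (a : DiffPoly υ) :
    coeffInclusion υ ι a′ = (coeffInclusion υ ι a)′ := by
  refine diffPoly_map_deriv _ (fun p => ?_) a
  rw [coeffInclusion_X, coeffInclusion_X, deriv_laurentVar]

/-- Differential homomorphisms out of the Laurent differential polynomial ring: the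
indeterminates may be sent to arbitrary elements `v`, as long as the derivatives of the `y_j` are
sent to units. -/
theorem exists_laurentHom {B : Type*} [CommRing B] [Algebra ℚ B] [Differential B]
    (v : (υ ⊕ ι) × ℕ → B) (hv : ∀ p, v (p.1, p.2 + 1) = (v p)′)
    (hu : ∀ p : ι × ℕ, IsUnit (v (Sum.inr p.1, p.2))) :
    ∃ f : LaurentDiffPoly υ ι →+* B, (∀ a, f a′ = (f a)′) ∧ ∀ p, f (laurentVar p) = v p := by
  let g : DiffPoly (υ ⊕ ι) →+* B := (MvPolynomial.aeval v).toRingHom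
  have hgX : ∀ p, g (MvPolynomial.X p) = v p := fun p => MvPolynomial.aeval_X v p
  have hg : ∀ m : yMonomials υ ι, IsUnit (g m) := by
    rintro ⟨m, hm⟩
    have hle : yMonomials υ ι ≤ (IsUnit.submonoid B).comap g := by
      refine Submonoid.closure_le.2 ?_
      rintro _ ⟨p, rfl⟩
      change IsUnit (g (MvPolynomial.X _))
      rw [hgX]
      exact hu p
    exact hle hm
  refine ⟨IsLocalization.lift hg, localization_map_deriv _ _ fun a => ?_, fun p => ?_⟩
  · rw [IsLocalization.lift_eq, IsLocalization.lift_eq]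
    exact diffPoly_map_deriv g (fun p => by rw [hgX, hgX, hv]) a
  · rw [laurentVar, IsLocalization.lift_eq, hgX]

theorem laurentHom_ext {B : Type*} [CommRing B] {f g : LaurentDiffPoly υ ι →+* B}
    (h : ∀ p, f (laurentVar p) = g (laurentVar p)) : f = g := by
  refine IsLocalization.ringHom_ext (yMonomials υ ι) ?_
  refine MvPolynomial.ringHom_ext (fun r => ?_) h
  exact congrArg (fun k : ℚ →+* B => k r) (Subsingleton.elim
    ((f.comp (algebraMap (DiffPoly (υ ⊕ ι)) _)).comp MvPolynomial.C)
    ((g.comp (algebraMap (DiffPoly (υ ⊕ ι)) _)).comp MvPolynomial.C))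

variable {E : Type*} [Field E] [Algebra (LaurentDiffPoly υ ι) E]
  [IsFractionRing (LaurentDiffPoly υ ι) E]

theorem toField_injective : Function.Injective (algebraMap (LaurentDiffPoly υ ι) E) :=
  IsFractionRing.injective (LaurentDiffPoly υ ι) E

/-- The indeterminates and their derivatives generate the field of fractions. -/
theorem eq_top_of_laurentVar_mem {F : Subfield E}
    (hF : ∀ p : (υ ⊕ ι) × ℕ, algebraMap (LaurentDiffPoly υ ι) E (laurentVar p) ∈ F) : F = ⊤ := by
  have h1 : ∀ a : DiffPoly (υ ⊕ ι), algebraMap (LaurentDiffPoly υ ι) E (algebraMap _ _ a) ∈ F := by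
    intro a
    induction a using MvPolynomial.induction_on with
    | C r =>
      let f : ℚ →+* E := (algebraMap (LaurentDiffPoly υ ι) E).comp
        ((algebraMap (DiffPoly (υ ⊕ ι)) (LaurentDiffPoly υ ι)).comp MvPolynomial.C)
      have h2 : f r = (r : E) := map_ratCast f r
      change f r ∈ F
      rw [h2]
      exact SubfieldClass.ratCast_mem F r
    | add p q hp hq =>
      rw [map_add, map_add]
      exact add_mem hp hq
    | mul_X p i hp =>
      rw [map_mul, map_mul]
      exact mul_mem hp (hF i)
  have h2 : ∀ a : LaurentDiffPoly υ ι, algebraMap (LaurentDiffPoly υ ι) E a ∈ F := by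
    intro a
    obtain ⟨⟨b, m⟩, hbm⟩ := IsLocalization.surj (yMonomials υ ι) a
    have hm : algebraMap (LaurentDiffPoly υ ι) E
        (algebraMap (DiffPoly (υ ⊕ ι)) _ (m : DiffPoly (υ ⊕ ι))) ≠ 0 :=
      ((IsLocalization.map_units (LaurentDiffPoly υ ι) m).map
        (algebraMap (LaurentDiffPoly υ ι) E)).ne_zero
    have h3 := congrArg (algebraMap (LaurentDiffPoly υ ι) E) hbm
    simp only [map_mul] at h3
    rw [← eq_div_iff hm] at h3
    rw [h3]
    exact div_mem (h1 b) (h1 m)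
  rw [eq_top_iff]
  rintro x -
  obtain ⟨a, b, -, rfl⟩ := IsFractionRing.div_surjective (A := LaurentDiffPoly υ ι) x
  exact div_mem (h2 a) (h2 b)

/-- Derivations of the field of fractions with prescribed values on the indeterminates. -/
theorem exists_derivation_laurentVar {N : Type*} [AddCommGroup N] [Module E N]
    (v : (υ ⊕ ι) × ℕ → N) : ∃ d : Derivation ℤ E N,
      ∀ p, d (algebraMap (LaurentDiffPoly υ ι) E (laurentVar p)) = v p := by
  let ψ : DiffPoly (υ ⊕ ι) →+* E := (algebraMap (LaurentDiffPoly υ ι) E).comp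
    (algebraMap (DiffPoly (υ ⊕ ι)) (LaurentDiffPoly υ ι))
  let _ : Module (DiffPoly (υ ⊕ ι)) N := Module.compHom N ψ
  let _ : Module ℚ N := Module.compHom N (algebraMap ℚ (DiffPoly (υ ⊕ ι)))
  have : IsScalarTower ℚ (DiffPoly (υ ⊕ ι)) N := ⟨fun r a w => by
    rw [Algebra.smul_def, mul_smul]
    rfl⟩
  let d0 : Derivation ℚ (DiffPoly (υ ⊕ ι)) N := MvPolynomial.mkDerivation ℚ v
  let _ : Module (LaurentDiffPoly υ ι) N :=
    Module.compHom N (algebraMap (LaurentDiffPoly υ ι) E)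
  obtain ⟨d1, hd1, hd1'⟩ := exists_derivation_extension (S := LaurentDiffPoly υ ι)
    (yMonomials υ ι) (d0 : DiffPoly (υ ⊕ ι) →+ N) (fun a b => (d0.leibniz a b).trans rfl)
  obtain ⟨d, hd, hd'⟩ := exists_derivation_extension (S := E)
    (nonZeroDivisors (LaurentDiffPoly υ ι)) d1 (fun a b => (hd1 a b).trans rfl)
  exact ⟨Derivation.mk' d.toIntLinearMap hd,
    fun p => (hd' _).trans ((hd1' _).trans (MvPolynomial.mkDerivation_X ℚ v p))⟩

end Laurent

/-! ### Logarithmic gradients of Laurent differential monomials -/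

section Gradient

variable {υ : Type} {n : ℕ} {E : Type*} [Field E] [Differential E]
  [Algebra (LaurentDiffPoly υ (Fin n)) E]

/-- A derivation of the field of fractions which kills the `u`'s and sends the derivatives of
`y_j` to those of the `j`-th standard vector multiplied by `y_j`, and which intertwines the
derivation of the field with the twisted derivative. -/
structure IsTwistedDerivation (Δ : Derivation ℤ E (Fin n → Polynomial E)) : Prop where
  map_inl : ∀ p : υ × ℕ,
    Δ (algebraMap (LaurentDiffPoly υ (Fin n)) E (laurentVar (Sum.inl p.1, p.2))) = 0
  map_inr : ∀ p : Fin n × ℕ,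
    Δ (algebraMap (LaurentDiffPoly υ (Fin n)) E (laurentVar (Sum.inr p.1, p.2))) =
      (twist E n)^[p.2] (Pi.single p.1 (Polynomial.C
        (algebraMap (LaurentDiffPoly υ (Fin n)) E (laurentVar (Sum.inr p.1, 0)))))
  map_deriv : ∀ x, Δ x′ = twist E n (Δ x)

/-- The twisted derivation is the differential of `y_j ↦ y_j (1 + ε_j e ^ (X z))`, where
`z′ = 1`. -/
theorem exists_isTwistedDerivation [IsFractionRing (LaurentDiffPoly υ (Fin n)) E]
    [DifferentialAlgebra (LaurentDiffPoly υ (Fin n)) E] :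
    ∃ Δ : Derivation ℤ E (Fin n → Polynomial E), IsTwistedDerivation (υ := υ) Δ := by
  let v : (υ ⊕ Fin n) × ℕ → Fin n → Polynomial E := fun p => match p.1 with
    | Sum.inl _ => 0
    | Sum.inr j => (twist E n)^[p.2] (Pi.single j (Polynomial.C
          (algebraMap (LaurentDiffPoly υ (Fin n)) E (laurentVar (Sum.inr j, 0)))))
  have hv : ∀ p, v (p.1, p.2 + 1) = twist E n (v p) := by
    rintro ⟨c | j, k⟩
    · exact (map_zero _).symm
    · exact Function.iterate_succ_apply' _ _ _
  obtain ⟨Δ, hΔX⟩ := exists_derivation_laurentVar (E := E) v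
  refine ⟨Δ, fun p => hΔX _, fun p => hΔX _, ?_⟩
  -- The defect of commutation is itself a derivation.
  let G0 : E →+ (Fin n → Polynomial E) :=
    { toFun := fun x => Δ x′ - twist E n (Δ x)
      map_zero' := by simp
      map_add' := fun x y => by
        simp only [map_add]
        abel }
  let G : Derivation ℤ E (Fin n → Polynomial E) := Derivation.mk' G0.toIntLinearMap fun x y => by
    change Δ (x * y)′ - twist E n (Δ (x * y)) =
      x • (Δ y′ - twist E n (Δ y)) + y • (Δ x′ - twist E n (Δ x))
    simp only [Derivation.leibniz, map_add, smul_eq_mul, twist_smul, smul_sub]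
    abel
  have hG : derivationKer G = ⊤ := by
    refine eq_top_of_laurentVar_mem (υ := υ) (ι := Fin n) fun p => ?_
    change Δ (algebraMap (LaurentDiffPoly υ (Fin n)) E (laurentVar p))′ -
      twist E n (Δ (algebraMap (LaurentDiffPoly υ (Fin n)) E (laurentVar p))) = 0
    rw [deriv_algebraMap, deriv_laurentVar, hΔX, hΔX, hv, sub_self]
  intro x
  have hx : x ∈ derivationKer G := by
    rw [hG]
    trivial
  exact sub_eq_zero.1 hx

/-- The unit underlying a Laurent differential monomial. -/
noncomputable def monomialUnit (υ : Type) {ι : Type} (β : ι × ℕ →₀ ℤ) : (LaurentDiffPoly υ ι)ˣ :=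
  β.prod fun p e => yUnit υ p ^ e

theorem coe_monomialUnit {ι : Type} (β : ι × ℕ →₀ ℤ) :
    (monomialUnit υ β : LaurentDiffPoly υ ι) = laurentMonomial υ β := rfl

theorem monomialUnit_add {ι : Type} (β γ : ι × ℕ →₀ ℤ) :
    monomialUnit υ (β + γ) = monomialUnit υ β * monomialUnit υ γ := by
  classical
  exact Finsupp.prod_add_index' (fun p => zpow_zero _) fun p a b => zpow_add _ a b

/-- The logarithmic gradient of a Laurent differential monomial, with respect to the twisted
derivation, as a vector over the Laurent differential polynomial ring. -/
noncomputable def logGradient (υ : Type) {n : ℕ} (β : Fin n × ℕ →₀ ℤ) :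
    Fin n → Polynomial (LaurentDiffPoly υ (Fin n)) :=
  β.sum fun p t => t • (((yUnit υ p)⁻¹ : (LaurentDiffPoly υ (Fin n))ˣ) :
    LaurentDiffPoly υ (Fin n)) • (twist _ n)^[p.2] (Pi.single p.1 (Polynomial.C
      (laurentVar (Sum.inr p.1, 0))))

/-- The logarithmic derivative of a derivation along the units. -/
noncomputable def logDerivHom {A E N : Type*} [CommRing A] [Field E] [AddCommGroup N] [Module E N]
    (ψ : A →+* E) (d : Derivation ℤ E N) : Aˣ →* Multiplicative N where
  toFun u := Multiplicative.ofAdd ((ψ u)⁻¹ • d (ψ u))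
  map_one' := by simp
  map_mul' u v := by
    have hu : ψ u ≠ 0 := (u.isUnit.map ψ).ne_zero
    have hv : ψ v ≠ 0 := (v.isUnit.map ψ).ne_zero
    rw [← ofAdd_add]
    congr 1
    rw [Units.val_mul, map_mul, Derivation.leibniz, smul_add, smul_smul, smul_smul, add_comm]
    congr 2
    · field_simp
    · field_simp

/-- Logarithmic differentiation of a Laurent differential monomial. -/
theorem IsTwistedDerivation.map_monomial [DifferentialAlgebra (LaurentDiffPoly υ (Fin n)) E]
    {Δ : Derivation ℤ E (Fin n → Polynomial E)} (hΔ : IsTwistedDerivation (υ := υ) Δ)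
    (β : Fin n × ℕ →₀ ℤ) :
    Δ (algebraMap (LaurentDiffPoly υ (Fin n)) E (laurentMonomial υ β)) =
      mapVec (algebraMap (LaurentDiffPoly υ (Fin n)) E) n
        (laurentMonomial υ β • logGradient υ β) := by
  set ψ := algebraMap (LaurentDiffPoly υ (Fin n)) E
  have hne : ψ (monomialUnit υ β) ≠ 0 :=
    ((monomialUnit υ β).isUnit.map _).ne_zero
  have h1 := congrArg Multiplicative.toAdd
    (map_finsuppProd (logDerivHom ψ Δ) β fun p e => yUnit υ p ^ e)
  have h2 : (ψ (monomialUnit υ β))⁻¹ • Δ (ψ (monomialUnit υ β)) =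
      mapVec ψ n (logGradient υ β) := by
    refine h1.trans ?_
    rw [Finsupp.prod, toAdd_prod, logGradient, Finsupp.sum, map_sum]
    refine Finset.sum_congr rfl fun p _ => ?_
    rw [map_zpow, toAdd_zpow, map_zsmul, mapVec_smul,
      mapVec_iterate_twist (fun a => (deriv_algebraMap a).symm), mapVec_single, Polynomial.map_C]
    congr 1
    change (ψ (yUnit υ p))⁻¹ • Δ (ψ (yUnit υ p)) = _
    rw [coe_yUnit, hΔ.map_inr]
    congr 1
    refine inv_eq_of_mul_eq_one_right ?_
    rw [← coe_yUnit, ← map_mul, Units.mul_inv, map_one]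
  rw [coe_monomialUnit] at h2 hne
  rw [mapVec_smul, ← h2, smul_smul, mul_inv_cancel₀ hne, one_smul]

end Gradient

/-! ### Differential independence from the symbolic support matrix -/

section LowerBound

/-- There is a differential field containing an exponential. -/
theorem exists_exponential : ∃ (F : Type) (_ : Field F) (_ : CharZero F) (_ : Differential F)
    (q : F), q ≠ 0 ∧ q′ = q := by
  -- The field `ℚ(X)` with the derivation `X d/dX`.
  let D : Differential (Polynomial ℚ) :=
    ⟨((Polynomial.X : Polynomial ℚ) • Polynomial.derivative' (R := ℚ)).restrictScalars ℤ⟩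
  have hX : (Polynomial.X : Polynomial ℚ)′ = Polynomial.X := by
    change (Polynomial.X : Polynomial ℚ) * Polynomial.derivative Polynomial.X = _
    rw [Polynomial.derivative_X, mul_one]
  have hinj := IsFractionRing.injective (Polynomial ℚ) (FractionRing (Polynomial ℚ))
  refine ⟨FractionRing (Polynomial ℚ), inferInstance,
    charZero_of_injective_algebraMap hinj, instDifferentialLocalization _,
    algebraMap (Polynomial ℚ) _ Polynomial.X, ?_, ?_⟩
  · exact (map_ne_zero_iff _ hinj).2 Polynomial.X_ne_zero
  · rw [algebraMap_deriv_localization, hX]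

/-- The coefficients of a vector of polynomials. -/
def vecCoeff (R : Type*) [CommRing R] (n : ℕ) :
    (Fin n → Polynomial R) →ₗ[R] (Fin n × ℕ → R) where
  toFun w p := (w p.1).coeff p.2
  map_add' v w := by
    funext p
    simp
  map_smul' a w := by
    funext p
    simp

theorem vecCoeff_injective (R : Type*) [CommRing R] (n : ℕ) :
    Function.Injective (vecCoeff R n) := by
  intro v w h
  funext j
  ext k
  exact congrFun h (j, k)

theorem linearIndependent_mapVec_of_specialization {A E F : Type*} [CommRing A] [Field E]
    [Field F] (φ : A →+* F) (ψ : A →+* E) (hψ : Function.Injective ψ) {n : ℕ} {ι : Type*}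
    {w : ι → Fin n → Polynomial A} (hw : LinearIndependent F fun i => mapVec φ n (w i)) :
    LinearIndependent E fun i => mapVec ψ n (w i) := by
  have h1 := hw.map' (vecCoeff F n) (LinearMap.ker_eq_bot.2 (vecCoeff_injective F n))
  refine LinearIndependent.of_comp (vecCoeff E n) ?_
  have h2 := linearIndependent_of_specialization
    (w := fun i (p : Fin n × ℕ) => (w i p.1).coeff p.2) φ ψ hψ
  have e1 : (fun i (b : Fin n × ℕ) => φ ((w i b.1).coeff b.2)) =
      (vecCoeff F n) ∘ fun i => mapVec φ n (w i) := by
    funext i p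
    simp [vecCoeff, mapVec_apply]
  have e2 : (fun i (b : Fin n × ℕ) => ψ ((w i b.1).coeff b.2)) =
      (vecCoeff E n) ∘ fun i => mapVec ψ n (w i) := by
    funext i p
    simp [vecCoeff, mapVec_apply]
  rw [e1, e2] at h2
  exact h2 h1

variable {υ : Type} {n : ℕ}

section Specialization

variable {F : Type*} [Field F] [Differential F] {q : F}
  {φ : LaurentDiffPoly υ (Fin n) →+* F} {m : Fin n → ℕ}

/-- At the exponential point `y_j = e ^ (m_j z)`, the logarithmic gradient of a monomial is its
symbolic support vector at `x_j = 1 + X / m_j`. -/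
theorem mapVec_logGradient [CharZero F] (hq : q ≠ 0) (hq' : q′ = q) (hm : ∀ j, 0 < m j)
    (hφ : ∀ a, φ a′ = (φ a)′)
    (hφy : ∀ p : Fin n × ℕ, φ (laurentVar (Sum.inr p.1, p.2)) = (m p.1 : F) ^ p.2 * q ^ m p.1)
    (β : Fin n × ℕ →₀ ℤ) : mapVec φ n (logGradient υ β) =
      symbolicEval (fun j => 1 + Polynomial.C (1 / (m j : F)) * Polynomial.X) β := by
  have hterm : ∀ p : Fin n × ℕ, mapVec φ n ((((yUnit υ p)⁻¹ : (LaurentDiffPoly υ (Fin n))ˣ) :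
      LaurentDiffPoly υ (Fin n)) • (twist _ n)^[p.2] (Pi.single p.1 (Polynomial.C
      (laurentVar (Sum.inr p.1, 0))))) =
      Pi.single p.1 ((1 + Polynomial.C (1 / (m p.1 : F)) * Polynomial.X) ^ p.2) := by
    intro p
    have hmF : (m p.1 : F) ≠ 0 := Nat.cast_ne_zero.2 (hm _).ne'
    have hinv : φ (((yUnit υ p)⁻¹ : (LaurentDiffPoly υ (Fin n))ˣ) : LaurentDiffPoly υ (Fin n)) =
        ((m p.1 : F) ^ p.2 * q ^ m p.1)⁻¹ := by
      rw [← hφy, ← coe_yUnit]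
      refine eq_inv_of_mul_eq_one_left ?_
      rw [← map_mul, Units.inv_mul, map_one]
    have hc : (q ^ m p.1)′ = ((m p.1 : ℤ) : F) * q ^ m p.1 := by
      obtain ⟨k, hk⟩ : ∃ k, m p.1 = k + 1 := ⟨m p.1 - 1, by have := hm p.1; omega⟩
      rw [Derivation.leibniz_pow, hq', hk]
      simp only [Nat.add_sub_cancel, smul_eq_mul, nsmul_eq_mul]
      push_cast
      ring
    have hs : (Pi.single p.1 (Polynomial.C (φ (laurentVar (Sum.inr p.1, 0)))) :
        Fin n → Polynomial F) = q ^ m p.1 • Pi.single p.1 1 := by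
      rw [hφy (p.1, 0), ← Pi.single_smul, Polynomial.smul_eq_C_mul, mul_one, pow_zero, one_mul]
    have hconst : ∀ j, Differential.mapCoeffs
        ((Pi.single p.1 1 : Fin n → Polynomial F) j) = 0 := by
      intro j
      by_cases h : j = p.1
      · subst h
        rw [Pi.single_eq_same, Derivation.map_one_eq_zero]
      · rw [Pi.single_eq_of_ne h, map_zero]
    rw [mapVec_smul, mapVec_iterate_twist hφ, mapVec_single, Polynomial.map_C, hs,
      iterate_twist_eq hc hconst, smul_smul, hinv, ← Pi.single_smul, ← Pi.single_smul]
    congr 1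
    rw [smul_eq_mul, mul_one, mul_inv, mul_assoc, inv_mul_cancel₀ (pow_ne_zero _ hq), mul_one,
      ← inv_pow, Polynomial.smul_eq_C_mul, Polynomial.C_pow, ← mul_pow]
    congr 1
    rw [mul_add, ← Polynomial.C_mul, Int.cast_natCast, inv_mul_cancel₀ hmF, Polynomial.C_1,
      one_div, add_comm]
  rw [logGradient, Finsupp.sum, map_sum]
  funext j
  rw [symbolicEval, Finsupp.sum, Finset.sum_apply]
  refine Finset.sum_congr rfl fun p _ => ?_
  rw [map_zsmul, hterm, Pi.smul_apply, zsmul_eq_mul]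
  split_ifs with h
  · subst h
    rw [Pi.single_eq_same]
  · rw [Pi.single_eq_of_ne (Ne.symm h), mul_zero]

/-- At the exponential point, monomials are exponentials. -/
theorem exists_deriv_map_monomial (hφ : ∀ a, φ a′ = (φ a)′)
    (hφy : ∀ p : Fin n × ℕ, φ (laurentVar (Sum.inr p.1, p.2 + 1)) =
      (m p.1 : F) * φ (laurentVar (Sum.inr p.1, p.2)))
    (β : Fin n × ℕ →₀ ℤ) :
    ∃ ω : ℤ, (φ (laurentMonomial υ β))′ = ω * φ (laurentMonomial υ β) := by
  let H : Subgroup (LaurentDiffPoly υ (Fin n))ˣ :=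
    { carrier := {u | ∃ ω : ℤ, (φ u)′ = ω * φ u}
      mul_mem' := by
        rintro a b ⟨ω, ha⟩ ⟨ω', hb⟩
        refine ⟨ω + ω', ?_⟩
        rw [Units.val_mul, map_mul, Derivation.leibniz, ha, hb, smul_eq_mul, smul_eq_mul]
        push_cast
        ring
      one_mem' := ⟨0, by simp⟩
      inv_mem' := by
        rintro a ⟨ω, ha⟩
        refine ⟨-ω, ?_⟩
        have h0 : φ a ≠ 0 := (a.isUnit.map φ).ne_zero
        have h1 : φ ((a⁻¹ : (LaurentDiffPoly υ (Fin n))ˣ) : LaurentDiffPoly υ (Fin n)) =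
            (φ a)⁻¹ := by
          refine eq_inv_of_mul_eq_one_left ?_
          rw [← map_mul, Units.inv_mul, map_one]
        rw [h1, deriv_inv_eq, ha]
        push_cast
        field_simp }
  have hy : ∀ p : Fin n × ℕ, yUnit υ p ∈ H := fun p => ⟨m p.1, by
    rw [coe_yUnit, ← hφ, deriv_laurentVar, hφy, Int.cast_natCast]⟩
  have h : monomialUnit υ β ∈ H := by
    rw [monomialUnit, Finsupp.prod]
    exact prod_mem fun p _ => H.zpow_mem (hy p) _
  exact h

end Specialization

variable {E : Type*} [Field E] [Differential E] [Algebra (LaurentDiffPoly υ (Fin n)) E]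

/-- Evaluation of differential polynomials at constants. -/
noncomputable def evalConst {σ : Type} (U : σ → ℚ) : DiffPoly σ →+* ℚ :=
  MvPolynomial.eval fun p => if p.2 = 0 then U p.1 else 0

theorem IsTwistedDerivation.map_coeffInclusion {Δ : Derivation ℤ E (Fin n → Polynomial E)}
    (hΔ : IsTwistedDerivation (υ := υ) Δ) (b : DiffPoly υ) :
    Δ (algebraMap (LaurentDiffPoly υ (Fin n)) E (coeffInclusion υ (Fin n) b)) = 0 := by
  induction b using MvPolynomial.induction_on with
  | C r =>
    let f : ℚ →+* E := (algebraMap (LaurentDiffPoly υ (Fin n)) E).comp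
      ((coeffInclusion υ (Fin n)).comp MvPolynomial.C)
    let _ : DivisionRing E := inferInstance
    have h2 : f r = (r : E) := map_ratCast f r
    have h3 : f r ∈ derivationKer Δ := by
      rw [h2]
      exact SubfieldClass.ratCast_mem _ r
    exact h3
  | add p q hp hq => rw [map_add, map_add, map_add, hp, hq, add_zero]
  | mul_X p i hp =>
    rw [map_mul, map_mul, Derivation.leibniz, hp, coeffInclusion_X, hΔ.map_inl, smul_zero,
      smul_zero, add_zero]

/-- Linear combinations of monomials, with coefficients in `ℚ{u}` which specialize to a single
monomial each, are differentially independent if the symbolic support vectors of these monomials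
are linearly independent. -/
theorem algebraicIndependent_of_symbolicEntry [CharZero E]
    [IsFractionRing (LaurentDiffPoly υ (Fin n)) E]
    [DifferentialAlgebra (LaurentDiffPoly υ (Fin n)) E] {K : Subfield E}
    (hK : ∀ Δ : Derivation ℤ E (Fin n → Polynomial E), IsTwistedDerivation (υ := υ) Δ →
      K ≤ derivationKer Δ)
    {κ : Type*} [Fintype κ] {τ : κ → Type*} [∀ i, Fintype (τ i)] (b : ∀ i, τ i → DiffPoly υ)
    (β : ∀ i, τ i → (Fin n × ℕ →₀ ℤ)) {f : κ → E}
    (hf : ∀ i, f i = algebraMap (LaurentDiffPoly υ (Fin n)) E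
      (∑ t, coeffInclusion υ (Fin n) (b i t) * laurentMonomial υ (β i t)))
    (U : υ → ℚ) (t₀ : ∀ i, τ i) (hb₀ : ∀ i, evalConst U (b i (t₀ i)) = 1)
    (hb : ∀ i, ∀ t ≠ t₀ i, evalConst U (b i t) = 0)
    (R : Type) [CommRing R] [IsDomain R]
    (h : LinearIndependent (FractionRing (MvPolynomial (Fin n) R)) fun i j =>
      algebraMap (MvPolynomial (Fin n) R) (FractionRing (MvPolynomial (Fin n) R))
        (symbolicEntry R (β i (t₀ i)) j)) :
    AlgebraicIndependent K fun p : κ × ℕ => (fun a : E => a′)^[p.2] (f p.1) := by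
  obtain ⟨m, hm, hli⟩ := exists_symbolicEval_linearIndependent R h
  obtain ⟨F, _, _, _, q, hq, hq'⟩ := exists_exponential
  obtain ⟨Δ, hΔ⟩ := exists_isTwistedDerivation (υ := υ) (n := n) (E := E)
  let ψ := algebraMap (LaurentDiffPoly υ (Fin n)) E
  have hψ : ∀ a, ψ a′ = (ψ a)′ := fun a => (deriv_algebraMap a).symm
  -- The specialization `u_c = U c`, `y_j = q ^ m_j`.
  let v : (υ ⊕ Fin n) × ℕ → F := fun p => match p.1 with
    | Sum.inl c => algebraMap ℚ F (if p.2 = 0 then U c else 0)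
    | Sum.inr j => (m j : F) ^ p.2 * q ^ m j
  have hqm : ∀ j, (q ^ m j)′ = (m j : F) * q ^ m j := by
    intro j
    obtain ⟨k, hk⟩ : ∃ k, m j = k + 1 := ⟨m j - 1, by have := hm j; omega⟩
    rw [Derivation.leibniz_pow, hq', hk]
    simp only [Nat.add_sub_cancel, smul_eq_mul, nsmul_eq_mul]
    push_cast
    ring
  obtain ⟨φ, hφ, hφv⟩ := exists_laurentHom v
    (by
      rintro ⟨c | j, k⟩
      · change algebraMap ℚ F (if k + 1 = 0 then U c else 0) = _
        rw [if_neg k.succ_ne_zero, map_zero]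
        exact (deriv_ringHom_rat (algebraMap ℚ F) _).symm
      · change (m j : F) ^ (k + 1) * q ^ m j = (((m j : F) ^ k * q ^ m j)′)
        rw [Derivation.leibniz, hqm, Derivation.leibniz_pow, Derivation.map_natCast]
        simp only [smul_eq_mul]
        ring)
    (fun p => isUnit_iff_ne_zero.2 (mul_ne_zero
      (pow_ne_zero _ (Nat.cast_ne_zero.2 (hm p.1).ne')) (pow_ne_zero _ hq)))
  have hφy : ∀ p : Fin n × ℕ,
      φ (laurentVar (Sum.inr p.1, p.2)) = (m p.1 : F) ^ p.2 * q ^ m p.1 := fun p => hφv _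
  have hφb : ∀ a : DiffPoly υ, φ (coeffInclusion υ (Fin n) a) =
      algebraMap ℚ F (evalConst U a) := by
    intro a
    have h1 : φ.comp (coeffInclusion υ (Fin n)) = (algebraMap ℚ F).comp (evalConst U) := by
      refine MvPolynomial.ringHom_ext (fun r => ?_) fun p => ?_
      · exact congrArg (fun k : ℚ →+* F => k r) (Subsingleton.elim
          ((φ.comp (coeffInclusion υ (Fin n))).comp MvPolynomial.C)
          (((algebraMap ℚ F).comp (evalConst U)).comp MvPolynomial.C))
      · rw [RingHom.comp_apply, coeffInclusion_X, hφv, RingHom.comp_apply, evalConst,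
          MvPolynomial.eval_X]
    exact congrArg (fun k => k a) h1
  -- The gradient of `f i`, before the passage to the field of fractions.
  let W : κ → Fin n → Polynomial (LaurentDiffPoly υ (Fin n)) := fun i =>
    ∑ t, coeffInclusion υ (Fin n) (b i t) • laurentMonomial υ (β i t) • logGradient υ (β i t)
  have hΔf : ∀ i, Δ (f i) = mapVec ψ n (W i) := by
    intro i
    rw [hf, map_sum, map_sum, map_sum]
    refine Finset.sum_congr rfl fun t _ => ?_
    rw [map_mul, Derivation.leibniz, hΔ.map_coeffInclusion, smul_zero, add_zero,
      hΔ.map_monomial]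
    exact (mapVec_smul ψ _ _).symm
  have hφW : ∀ i, mapVec φ n (W i) = φ (laurentMonomial υ (β i (t₀ i))) • symbolicEval
      (fun j => 1 + Polynomial.C (1 / (m j : F)) * Polynomial.X) (β i (t₀ i)) := by
    intro i
    rw [map_sum, Finset.sum_eq_single (t₀ i)]
    · rw [mapVec_smul, hφb, hb₀, map_one, one_smul, mapVec_smul,
        mapVec_logGradient hq hq' hm hφ hφy]
    · intro t _ ht
      rw [mapVec_smul, hφb, hb i t ht, map_zero, zero_smul]
    · exact fun h0 => absurd (Finset.mem_univ _) h0
  choose ω hω using fun i => exists_deriv_map_monomial (m := m) hφ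
    (fun p => by rw [hφy (p.1, p.2 + 1), hφy]; ring) (β i (t₀ i))
  have hF := linearIndependent_iterate_twist hli
    (c := fun i => φ (laurentMonomial υ (β i (t₀ i))))
    (fun i => ((monomialUnit υ (β i (t₀ i))).isUnit.map φ).ne_zero) hω
  have hE : LinearIndependent E fun p : κ × ℕ => mapVec ψ n ((twist _ n)^[p.2] (W p.1)) := by
    refine linearIndependent_mapVec_of_specialization φ ψ
      (IsFractionRing.injective (LaurentDiffPoly υ (Fin n)) E) ?_
    simp only [mapVec_iterate_twist hφ, hφW]
    exact hF
  refine algebraicIndependent_of_derivation Δ (hK Δ hΔ) ?_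
  have hcomm : ∀ (k : ℕ) (x : E), Δ ((fun a : E => a′)^[k] x) = (twist E n)^[k] (Δ x) := by
    intro k x
    induction k with
    | zero => rfl
    | succ k ih => rw [Function.iterate_succ_apply', Function.iterate_succ_apply', hΔ.map_deriv, ih]
  simp only [hcomm, hΔf]
  simpa only [mapVec_iterate_twist hψ] using hE

end LowerBound

/-! ### Generic ranks -/

section Rank

/-- A finite family of vectors has a subfamily in which every vector depends on the other ones,
and such that the remaining vectors raise the dimension by one each. -/
theorem exists_dependent_subfamily {Ω V ι : Type*} [Field Ω] [AddCommGroup V] [Module Ω V]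
    [Fintype ι] [DecidableEq ι] (v : ι → V) :
    ∃ I : Finset ι, Module.finrank Ω (Submodule.span Ω (v '' I)) + Iᶜ.card ≤
        Module.finrank Ω (Submodule.span Ω (Set.range v)) ∧
      ∀ i ∈ I, v i ∈ Submodule.span Ω (v '' (I.erase i : Finset ι)) := by
  let P : Finset ι → Prop := fun I => Module.finrank Ω (Submodule.span Ω (v '' I)) + Iᶜ.card ≤
        Module.finrank Ω (Submodule.span Ω (Set.range v))
  have hP : P Finset.univ := by
    change _ + _ ≤ _
    rw [Finset.coe_univ, Set.image_univ, Finset.compl_univ, Finset.card_empty, add_zero]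
  classical
  -- In a minimal subfamily with this property, removing a vector cannot lower the dimension.
  obtain ⟨I, hI, hmin⟩ := (Finset.univ.filter P).exists_min_image Finset.card
    ⟨Finset.univ, Finset.mem_filter.2 ⟨Finset.mem_univ _, hP⟩⟩
  have hPI : P I := (Finset.mem_filter.1 hI).2
  refine ⟨I, hPI, fun i hi => ?_⟩
  have hnot : ¬ P (I.erase i) := fun h0 => by
    have h1 := hmin _ (Finset.mem_filter.2 ⟨Finset.mem_univ _, h0⟩)
    have h2 := Finset.card_erase_lt_of_mem hi
    omega
  have hle : Submodule.span Ω (v '' (I.erase i : Finset ι)) ≤ Submodule.span Ω (v '' I) :=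
    Submodule.span_mono (Set.image_mono (Finset.coe_subset.2 (Finset.erase_subset i I)))
  have hfin : FiniteDimensional Ω (Submodule.span Ω (v '' I)) :=
    FiniteDimensional.span_of_finite Ω (I.finite_toSet.image v)
  have hcard : (I.erase i)ᶜ.card = Iᶜ.card + 1 := by
    have h1 := Finset.card_add_card_compl I
    have h2 := Finset.card_add_card_compl (I.erase i)
    have h3 := Finset.card_erase_add_one hi
    omega
  have heq := Submodule.eq_of_le_of_finrank_le hle (by
    simp only [P] at hPI hnot
    omega)
  rw [heq]
  exact Submodule.subset_span ⟨i, hi, rfl⟩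

/-- A ring endomorphism fixing the vectors of `S` preserves their span. -/
theorem map_mem_span_of_fixed {Ω β : Type*} [Field Ω] (σ : Ω →+* Ω) {S : Set (β → Ω)}
    (hS : ∀ w ∈ S, (fun b => σ (w b)) = w) {w : β → Ω} (hw : w ∈ Submodule.span Ω S) :
    (fun b => σ (w b)) ∈ Submodule.span Ω S := by
  induction hw using Submodule.span_induction with
  | mem w hw =>
    rw [hS w hw]
    exact Submodule.subset_span hw
  | zero =>
    simp only [Pi.zero_apply, map_zero]
    exact zero_mem _
  | add v w _ _ hv hw =>
    simp only [Pi.add_apply, map_add]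
    exact add_mem hv hw
  | smul a w _ hw =>
    simp only [Pi.smul_apply, smul_eq_mul, map_mul]
    exact Submodule.smul_mem _ (σ a) hw

/-- Translations of polynomial rings. -/
theorem exists_translation {σ R : Type*} [CommRing R] (a : σ → R) :
    ∃ g : MvPolynomial σ R →ₐ[R] MvPolynomial σ R, Function.Injective g ∧
      ∀ s, g (MvPolynomial.X s) = MvPolynomial.X s + MvPolynomial.C (a s) := by
  let g : MvPolynomial σ R →ₐ[R] MvPolynomial σ R :=
    MvPolynomial.aeval fun s => MvPolynomial.X s + MvPolynomial.C (a s)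
  let g' : MvPolynomial σ R →ₐ[R] MvPolynomial σ R :=
    MvPolynomial.aeval fun s => MvPolynomial.X s - MvPolynomial.C (a s)
  have h : g'.comp g = AlgHom.id R _ := by
    refine MvPolynomial.algHom_ext fun s => ?_
    simp [g, g', MvPolynomial.algebraMap_eq]
  refine ⟨g, Function.LeftInverse.injective (g := g') fun p => ?_, fun s => by simp [g]⟩
  exact congrArg (fun f => f p) h

theorem exists_fractionRing_extension {R : Type*} [CommRing R] [IsDomain R] {g : R →+* R}
    (hg : Function.Injective g) : ∃ σ : FractionRing R →+* FractionRing R,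
      ∀ a, σ (algebraMap R _ a) = algebraMap R _ (g a) :=
  ⟨IsFractionRing.map hg, fun a => by simp [IsFractionRing.map]⟩

variable {n : ℕ}

theorem symbolicEval_eq_sum {R : Type*} [CommRing R] (a : Fin n → R) {β : Fin n × ℕ →₀ ℤ} {D : ℕ}
    (hD : ∀ p ∈ β.support, p.2 < D) (j : Fin n) :
    symbolicEval a β j = ∑ r ∈ Finset.range D, (β (j, r) : R) * a j ^ r := by
  rw [symbolicEval, Finsupp.sum, ← Finset.sum_filter]
  symm
  rw [← Finset.sum_subset (s₁ := (Finset.range D).filter fun r => (j, r) ∈ β.support)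
    (Finset.filter_subset _ _)]
  · refine Finset.sum_bij' (fun r _ => (j, r)) (fun p _ => p.2) ?_ ?_ ?_ ?_ ?_
    · intro r hr
      exact Finset.mem_filter.2 ⟨(Finset.mem_filter.1 hr).2, rfl⟩
    · intro p hp
      have h1 := Finset.mem_filter.1 hp
      have h2 : (j, p.2) = p := Prod.ext h1.2.symm rfl
      exact Finset.mem_filter.2 ⟨Finset.mem_range.2 (hD p h1.1), by rw [h2]; exact h1.1⟩
    · intro r _
      rfl
    · intro p hp
      exact Prod.ext (Finset.mem_filter.1 hp).2.symm rfl
    · intro r _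
      rfl
  · intro r hr hr'
    have h0 : β (j, r) = 0 := by
      by_contra hne
      exact hr' (Finset.mem_filter.2 ⟨hr, Finsupp.mem_support_iff.2 hne⟩)
    rw [h0, Int.cast_zero, zero_mul]

/-- The rank of the symbolic support matrix of a finite family of monomials. -/
noncomputable def supportRank (R : Type) [CommRing R] [IsDomain R] {ρ : Type*}
    (β : ρ → (Fin n × ℕ →₀ ℤ)) : ℕ :=
  (Matrix.of fun a j => algebraMap (MvPolynomial (Fin n) R)
    (FractionRing (MvPolynomial (Fin n) R)) (symbolicEntry R (β a) j)).rank

/-- Translating `x_j` shows that, for a set `J` of columns each depending on the other ones, the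
span of these columns contains all their coefficient vectors. Hence there are few monomials of
which all the others are, up to powers and up to the `y_j` with `j ∉ J`, power products. -/
theorem exists_monomial_basis (R : Type) [CommRing R] [IsDomain R] [CharZero R] {ρ : Type*}
    [Fintype ρ] (β : ρ → (Fin n × ℕ →₀ ℤ)) :
    ∃ (J : Finset (Fin n)) (B : Finset ρ), B.card + Jᶜ.card ≤ supportRank R β ∧
      ∀ a, ∃ N : ℕ, N ≠ 0 ∧ ∃ e : B → ℤ, ∀ p : Fin n × ℕ, p.1 ∈ J →
        (N : ℤ) * β a p = ∑ k, e k * β k p := by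
  classical
  let P := MvPolynomial (Fin n) R
  let Ω := FractionRing P
  have hΩ : Function.Injective (algebraMap P Ω) := IsFractionRing.injective P Ω
  have : CharZero Ω := charZero_of_injective_algebraMap hΩ
  let c : Fin n → ρ → Ω := fun j a => algebraMap P Ω (symbolicEntry R (β a) j)
  obtain ⟨J, hJ, hdep⟩ := exists_dependent_subfamily (Ω := Ω) c
  set W := Submodule.span Ω (c '' J) with hW
  -- Translates of the columns in `J` stay in their span.
  have hshift : ∀ j ∈ J, ∀ s : ℕ, (fun a => symbolicEval
      (fun i => algebraMap P Ω (MvPolynomial.X i) + (s : Ω)) (β a) j) ∈ W := by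
    intro j hj s
    obtain ⟨g, hg, hgX⟩ := exists_translation (R := R) (Pi.single j (s : R) : Fin n → R)
    obtain ⟨σ, hσ⟩ := exists_fractionRing_extension (g := (g : P →+* P)) hg
    have hσc : ∀ i, (fun a => σ (c i a)) = fun a => symbolicEval (fun k => algebraMap P Ω
        (MvPolynomial.X k + MvPolynomial.C ((Pi.single j (s : R) : Fin n → R) k))) (β a) i := by
      intro i
      funext a
      simp only [c, symbolicEntry_eq, map_symbolicEval]
      congr 1
      funext k
      exact (hσ _).trans (congrArg (algebraMap P Ω) (hgX k))
    have h1 := map_mem_span_of_fixed σ (S := c '' (J.erase j : Finset (Fin n))) (by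
      rintro _ ⟨i, hi, rfl⟩
      rw [hσc]
      funext a
      have hij : i ≠ j := (Finset.mem_erase.1 hi).1
      simp only [c, symbolicEntry_eq, map_symbolicEval]
      simp only [symbolicEval, Finsupp.sum, Pi.single_eq_of_ne hij, map_zero, add_zero])
      (hdep j hj)
    rw [hσc] at h1
    have h2 := Submodule.span_mono (Set.image_mono
      (Finset.coe_subset.2 (Finset.erase_subset j J))) h1
    convert h2 using 1
    funext a
    simp only [symbolicEval, Finsupp.sum, Pi.single_eq_same, map_add, map_natCast]
  obtain ⟨D, hD⟩ : ∃ D : ℕ, ∀ a, ∀ p ∈ (β a).support, p.2 < D := by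
    refine ⟨(Finset.univ.sup fun a => (β a).support.sup Prod.snd) + 1, fun a p hp => ?_⟩
    have h1 : p.2 ≤ (β a).support.sup Prod.snd := Finset.le_sup (f := Prod.snd) hp
    have h2 : (β a).support.sup Prod.snd ≤ Finset.univ.sup fun a => (β a).support.sup Prod.snd :=
      Finset.le_sup (f := fun a => (β a).support.sup Prod.snd) (Finset.mem_univ a)
    omega
  -- The coefficient vectors of the columns in `J` lie there too: a functional `f` vanishing on `W`
  -- gives a polynomial `Q` with coefficients `f (c_{jr})` and infinitely many roots.
  have hcoeff : ∀ p : Fin n × ℕ, p.1 ∈ J → (fun a => ((β a p : ℤ) : Ω)) ∈ W := by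
    rintro ⟨j, r⟩ hj
    by_contra hnot
    obtain ⟨f, hf, hfW⟩ := Submodule.exists_le_ker_of_notMem hnot
    apply hf
    let Q : Polynomial Ω := ∑ r ∈ Finset.range D,
      Polynomial.monomial r (f fun a => ((β a (j, r) : ℤ) : Ω))
    have hQ : Q = 0 := by
      refine Polynomial.eq_zero_of_infinite_isRoot Q (Set.Infinite.mono
        (s := Set.range fun s : ℕ => algebraMap P Ω (MvPolynomial.X j) + (s : Ω)) ?_
        (Set.infinite_range_of_injective fun s t h => by simpa using h))
      rintro _ ⟨s, rfl⟩
      have h1 : f _ = 0 := hfW (hshift j hj s)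
      change Polynomial.eval _ Q = 0
      rw [← h1, Polynomial.eval_finsetSum]
      have h2 : (fun a => symbolicEval
          (fun i => algebraMap P Ω (MvPolynomial.X i) + (s : Ω)) (β a) j) =
          ∑ r ∈ Finset.range D, (algebraMap P Ω (MvPolynomial.X j) + (s : Ω)) ^ r •
            fun a => ((β a (j, r) : ℤ) : Ω) := by
        funext a
        rw [symbolicEval_eq_sum _ (hD a), Finset.sum_apply]
        refine Finset.sum_congr rfl fun r _ => ?_
        simp [mul_comm]
      rw [h2, map_sum]
      refine Finset.sum_congr rfl fun r _ => ?_
      rw [map_smul, Polynomial.eval_monomial, smul_eq_mul, mul_comm]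
    by_cases hr : r < D
    · have h1 := congrArg (fun q => Polynomial.coeff q r) hQ
      simp only [Q, Polynomial.finsetSum_coeff, Polynomial.coeff_monomial,
        Polynomial.coeff_zero] at h1
      rw [Finset.sum_ite_eq' (Finset.range D) r, if_pos (Finset.mem_range.2 hr)] at h1
      exact h1
    · have h0 : (fun a => ((β a (j, r) : ℤ) : Ω)) = 0 := by
        funext a
        have : β a (j, r) = 0 := by
          by_contra hne
          exact hr (hD a _ (Finsupp.mem_support_iff.2 hne))
        rw [this, Int.cast_zero, Pi.zero_apply]
      rw [h0, map_zero]
  -- A maximal linearly independent set of rows of exponents, restricted to the columns in `J`.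
  let row : ρ → Fin n × ℕ → ℚ := fun a p => if p.1 ∈ J then (β a p : ℚ) else 0
  obtain ⟨κ, b, hb, hspan, hli⟩ := exists_linearIndependent' ℚ row
  have : Fintype κ := Fintype.ofInjective b hb
  obtain ⟨e, he⟩ := exists_det_ne_zero_of_linearIndependent hli
  have hcard : Fintype.card κ ≤ Module.finrank Ω W := by
    let w : κ → W := fun k => ⟨fun a => algebraMap ℚ Ω (row a (e k)), by
      by_cases h : (e k).1 ∈ J
      · simpa [row, h] using hcoeff _ h
      · simp only [row, h, if_false, map_zero]
        exact zero_mem W⟩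
    have hw : LinearIndependent Ω w := by
      refine LinearIndependent.of_comp ((LinearMap.funLeft Ω Ω b).comp W.subtype) ?_
      have h1 : (algebraMap ℚ Ω).mapMatrix (Matrix.of fun i k => row (b i) (e k)) =
          Matrix.of fun i k => algebraMap ℚ Ω (row (b i) (e k)) := rfl
      have h2 : (Matrix.of fun i k => algebraMap ℚ Ω (row (b i) (e k))).det ≠ 0 := by
        rw [← h1, ← RingHom.map_det]
        exact (map_ne_zero _).2 he
      exact Matrix.linearIndependent_cols_iff_isUnit.2
        ((Matrix.isUnit_iff_isUnit_det _).2 (isUnit_iff_ne_zero.2 h2))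
    exact hw.fintype_card_le_finrank
  refine ⟨J, Finset.univ.image b, ?_, fun a => ?_⟩
  · rw [Finset.card_image_of_injective _ hb, Finset.card_univ, supportRank,
      Matrix.rank_eq_finrank_span_cols]
    exact (Nat.add_le_add_right hcard _).trans hJ
  · have ha : row a ∈ Submodule.span ℚ (Set.range fun k : (Finset.univ.image b) => row k) := by
      have h1 : row a ∈ Submodule.span ℚ (Set.range (row ∘ b)) := by
        rw [hspan]
        exact Submodule.subset_span ⟨a, rfl⟩
      refine Submodule.span_mono ?_ h1
      rintro _ ⟨k, rfl⟩
      exact ⟨⟨b k, Finset.mem_image_of_mem _ (Finset.mem_univ k)⟩, rfl⟩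
    obtain ⟨x, hx⟩ := (Submodule.mem_span_range_iff_exists_fun ℚ).1 ha
    obtain ⟨N, hN⟩ := IsLocalization.exist_integer_multiples_of_finite (nonZeroDivisors ℤ) x
    choose y hy using hN
    have hN0 : (N : ℤ) ≠ 0 := nonZeroDivisors.ne_zero N.2
    refine ⟨(N : ℤ).natAbs, Int.natAbs_ne_zero.2 hN0, fun k => (N : ℤ).sign * y k,
      fun p hp => ?_⟩
    have h3 : ((N : ℤ) : ℚ) * β a p = ∑ k, (y k : ℚ) * β k p := by
      have h4 := congrArg (fun w => ((N : ℤ) : ℚ) * w p) hx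
      simp only [Finset.sum_apply, Pi.smul_apply, smul_eq_mul, row, hp, if_true,
        Finset.mul_sum] at h4
      rw [← h4]
      refine Finset.sum_congr rfl fun k _ => ?_
      have h5 := hy k
      rw [Algebra.smul_def] at h5
      simp only [algebraMap_int_eq, eq_intCast] at h5
      rw [h5, mul_assoc]
    have h6 : (N : ℤ) * β a p = ∑ k, y k * β k p := by exact_mod_cast h3
    have h7 : (((N : ℤ).natAbs : ℕ) : ℤ) = (N : ℤ).sign * (N : ℤ) := by
      rw [Int.natCast_natAbs, Int.sign_mul_self_eq_abs]
    rw [h7, mul_assoc, h6, Finset.mul_sum]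
    exact Finset.sum_congr rfl fun k _ => (mul_assoc _ _ _).symm

end Rank

/-! ### Ranks of symbolic support matrices of generic systems -/

section GenericRank

/-- Linearly independent vectors may be replaced, one at a time, by members of sets whose spans
contain them. -/
theorem exists_linearIndependent_mem {Ω V κ : Type*} [Field Ω] [AddCommGroup V] [Module Ω V]
    [Fintype κ] {v : κ → V} (hv : LinearIndependent Ω v) (S : κ → Set V)
    (hS : ∀ k, v k ∈ Submodule.span Ω (S k)) :
    ∃ w : κ → V, (∀ k, w k ∈ S k) ∧ LinearIndependent Ω w := by
  classical
  suffices h : ∀ s : Finset κ, ∃ w : κ → V, (∀ k ∈ s, w k ∈ S k) ∧ (∀ k ∉ s, w k = v k) ∧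
      LinearIndependent Ω w by
    obtain ⟨w, hw, -, hli⟩ := h Finset.univ
    exact ⟨w, fun k => hw k (Finset.mem_univ k), hli⟩
  intro s
  induction s using Finset.induction_on with
  | empty => exact ⟨v, by simp, fun _ _ => rfl, hv⟩
  | insert k s hk ih =>
    obtain ⟨w, hw, hwv, hli⟩ := ih
    have hnot : w k ∉ Submodule.span Ω (w '' {k}ᶜ) := hli.notMem_span_image (by simp)
    obtain ⟨x, hxS, hx⟩ : ∃ x ∈ S k, x ∉ Submodule.span Ω (w '' {k}ᶜ) := by
      by_contra! h0
      exact hnot (hwv k hk ▸ Submodule.span_le.2 h0 (hS k))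
    refine ⟨Function.update w k x, fun i hi => ?_, fun i hi => ?_, ?_⟩
    · by_cases h : i = k
      · subst h
        rwa [Function.update_self]
      · rw [Function.update_of_ne h]
        exact hw i (Finset.mem_of_mem_insert_of_ne hi h)
    · rw [Finset.mem_insert, not_or] at hi
      rw [Function.update_of_ne hi.1]
      exact hwv i hi.2
    · have hins : insert k ({k}ᶜ : Set κ) = Set.univ := by
        ext i
        by_cases h : i = k <;> simp [h]
      have heq : Set.EqOn (Function.update w k x) w {k}ᶜ := fun i hi =>
        Function.update_of_ne hi _ _
      rw [← linearIndepOn_univ_iff, ← hins, linearIndepOn_insert (by simp), heq.image_eq,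
        Function.update_self]
      exact ⟨(linearIndepOn_congr heq).2 (hli.linearIndepOn _), hx⟩

theorem exists_finset_linearIndependent {Ω V ι : Type*} [Field Ω] [AddCommGroup V]
    [Module Ω V] [Fintype ι] (v : ι → V) : ∃ I : Finset ι,
      I.card = Module.finrank Ω (Submodule.span Ω (Set.range v)) ∧
        LinearIndependent Ω fun i : I => v i := by
  classical
  obtain ⟨κ, a, ha, hspan, hli⟩ := exists_linearIndependent' Ω v
  have : Fintype κ := Fintype.ofInjective a ha
  refine ⟨Finset.univ.image a, ?_, ?_⟩
  · rw [Finset.card_image_of_injective _ ha, Finset.card_univ, ← hspan, finrank_span_eq_card hli]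
  · choose x _ hx using fun i : Finset.univ.image a => Finset.mem_image.1 i.2
    have h1 := hli.comp x (fun i j h => Subtype.ext (by rw [← hx i, ← hx j, h]))
    have h2 : (fun i : Finset.univ.image a => v i) = (v ∘ a) ∘ x := by
      funext i
      simp only [Function.comp_apply, hx]
    rw [h2]
    exact h1

variable {n : ℕ} {l : Fin (n + 1) → ℕ}

/-- The exponent vector of `M_{ik} / M_{i0}`. -/
noncomputable abbrev ratioExponent (α : (i : Fin (n + 1)) → Fin (l i + 1) → (Fin n × ℕ →₀ ℤ))
    (c : CoeffIdx l) : Fin n × ℕ →₀ ℤ :=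
  α c.1 c.2 - α c.1 0

/-- The field of fractions of the ring of the entries of the symbolic support matrix. -/
abbrev SupportField (l : Fin (n + 1) → ℕ) : Type :=
  FractionRing (MvPolynomial (Fin n) (DiffPoly (CoeffIdx l)))

/-- The symbolic support vector of `M_{ik} / M_{i0}` over the field of fractions. -/
noncomputable def ratioVector (α : (i : Fin (n + 1)) → Fin (l i + 1) → (Fin n × ℕ →₀ ℤ))
    (c : CoeffIdx l) : Fin n → SupportField l :=
  fun j => algebraMap (MvPolynomial (Fin n) (DiffPoly (CoeffIdx l))) _
    (symbolicEntry (DiffPoly (CoeffIdx l)) (ratioExponent α c) j)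

/-- The `i`-th row of the symbolic support matrix over the field of fractions. -/
noncomputable def supportRow (α : (i : Fin (n + 1)) → Fin (l i + 1) → (Fin n × ℕ →₀ ℤ))
    (i : Fin (n + 1)) : Fin n → SupportField l :=
  fun j => algebraMap (MvPolynomial (Fin n) (DiffPoly (CoeffIdx l))) _
    (symbolicSupportMatrix α i j)

variable (α : (i : Fin (n + 1)) → Fin (l i + 1) → (Fin n × ℕ →₀ ℤ))

theorem fracRank_eq_finrank_span : fracRank (symbolicSupportMatrix α) =
    Module.finrank (SupportField l) (Submodule.span (SupportField l)
      (Set.range (supportRow α))) := by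
  rw [fracRank, Matrix.rank_eq_finrank_span_row]
  rfl

theorem supportRow_eq (i : Fin (n + 1)) : supportRow α i = ∑ k : Fin (l i + 1),
    algebraMap (MvPolynomial (Fin n) (DiffPoly (CoeffIdx l))) (SupportField l)
      (MvPolynomial.C (MvPolynomial.X (⟨i, k⟩, 0))) • ratioVector α ⟨i, k⟩ := by
  funext j
  simp only [supportRow, symbolicSupportMatrix, Matrix.of_apply, map_sum, map_mul,
    Finset.sum_apply, Pi.smul_apply, smul_eq_mul, ratioVector]

theorem ratioVector_zero (i : Fin (n + 1)) : ratioVector α ⟨i, 0⟩ = 0 := by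
  funext j
  simp [ratioVector, ratioExponent, symbolicEntry]

/-- Translating `u_{ik}` shows that, for a set `I` of rows each depending on the other ones, the
span of these rows contains the symbolic support vectors of all `M_{ik} / M_{i0}` with `i ∈ I`. -/
theorem exists_row_bound : ∃ I : Finset (Fin (n + 1)),
    supportRank (DiffPoly (CoeffIdx l))
      (fun c : {c : CoeffIdx l // c.1 ∈ I} => ratioExponent α c) + Iᶜ.card ≤
        fracRank (symbolicSupportMatrix α) := by
  classical
  let P := MvPolynomial (Fin n) (DiffPoly (CoeffIdx l))
  obtain ⟨I, hI, hdep⟩ := exists_dependent_subfamily (Ω := SupportField l) (supportRow α)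
  refine ⟨I, ?_⟩
  have hmem : ∀ c : CoeffIdx l, c.1 ∈ I →
      ratioVector α c ∈ Submodule.span (SupportField l) (supportRow α '' I) := by
    rintro ⟨i, k⟩ hi
    obtain ⟨g, hg, hgX⟩ := exists_translation (R := ℚ) (Pi.single (⟨i, k⟩, 0) 1 :
      CoeffIdx l × ℕ → ℚ)
    obtain ⟨σ, hσ⟩ := exists_fractionRing_extension
      (g := MvPolynomial.map (σ := Fin n) (g : DiffPoly (CoeffIdx l) →+* DiffPoly (CoeffIdx l)))
      (MvPolynomial.map_injective _ hg)
    -- `σ` changes only the `i`-th row, by the vector in question.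
    have hσr : ∀ i', (fun j => σ (supportRow α i' j)) = supportRow α i' +
        ∑ k' : Fin (l i' + 1), (if (⟨i', k'⟩ : CoeffIdx l) = ⟨i, k⟩ then 1 else 0 :
          SupportField l) • ratioVector α ⟨i', k'⟩ := by
      intro i'
      have hσv : ∀ c j, σ (ratioVector α c j) = ratioVector α c j := by
        intro c j
        refine (hσ _).trans ?_
        simp only [symbolicEntry_eq, map_symbolicEval, MvPolynomial.map_X, ratioVector]
      rw [supportRow_eq, ← Finset.sum_add_distrib]
      funext j
      simp only [Finset.sum_apply, map_sum, Pi.smul_apply, smul_eq_mul, map_mul, Pi.add_apply, hσv]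
      refine Finset.sum_congr rfl fun k' _ => ?_
      rw [← add_mul]
      congr 1
      refine (hσ _).trans ?_
      rw [MvPolynomial.map_C]
      have h1 := hgX ((⟨i', k'⟩ : CoeffIdx l), 0)
      rw [RingHom.coe_coe, h1, map_add, map_add]
      congr 1
      by_cases h : (⟨i', k'⟩ : CoeffIdx l) = ⟨i, k⟩
      · rw [h, Pi.single_eq_same, if_pos rfl, map_one, map_one, map_one]
      · rw [if_neg h, Pi.single_eq_of_ne (fun h0 => h (congrArg Prod.fst h0)), map_zero, map_zero,
          map_zero]
    have h1 := map_mem_span_of_fixed σ (S := supportRow α '' (I.erase i : Finset _)) (by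
      rintro _ ⟨i', hi', rfl⟩
      rw [hσr, add_eq_left]
      refine Finset.sum_eq_zero fun k' _ => ?_
      rw [if_neg, zero_smul]
      intro h0
      exact (Finset.mem_erase.1 hi').1 (congrArg Sigma.fst h0)) (hdep i hi)
    have hsum : ∑ k' : Fin (l i + 1), (if (⟨i, k'⟩ : CoeffIdx l) = ⟨i, k⟩ then 1 else 0 :
          SupportField l) • ratioVector α ⟨i, k'⟩ = ratioVector α ⟨i, k⟩ := by
      rw [Finset.sum_eq_single k]
      · rw [if_pos rfl, one_smul]
      · intro k' _ hk'
        rw [if_neg, zero_smul]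
        intro h0
        exact hk' (eq_of_heq (Sigma.mk.inj h0).2)
      · exact fun h0 => absurd (Finset.mem_univ _) h0
    rw [hσr, hsum] at h1
    have h2 := sub_mem h1 (hdep i hi)
    rw [add_sub_cancel_left] at h2
    exact Submodule.span_mono (Set.image_mono
      (Finset.coe_subset.2 (Finset.erase_subset i I))) h2
  rw [fracRank_eq_finrank_span]
  refine le_trans (Nat.add_le_add_right ?_ _) hI
  rw [supportRank, Matrix.rank_eq_finrank_span_row]
  refine Submodule.finrank_mono (Submodule.span_le.2 ?_)
  rintro _ ⟨c, rfl⟩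
  exact hmem c.1 c.2

/-- The rank of the symbolic support matrix is attained by the symbolic support vectors of a
selection of monomials. -/
theorem exists_selection (hl : ∀ i, 1 ≤ l i) :
    ∃ (I : Finset (Fin (n + 1))) (k : (i : Fin (n + 1)) → Fin (l i + 1)),
      I.card = fracRank (symbolicSupportMatrix α) ∧ (∀ i, k i ≠ 0) ∧
      LinearIndependent (SupportField l) fun i : I => ratioVector α ⟨i, k i⟩ := by
  classical
  obtain ⟨κ, a, ha, hspan, hli⟩ := exists_linearIndependent' (SupportField l) (supportRow α)
  have : Fintype κ := Fintype.ofInjective a ha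
  obtain ⟨w, hw, hwli⟩ := exists_linearIndependent_mem hli
    (fun x => Set.range fun k => ratioVector α ⟨a x, k⟩) (fun x => by
      rw [Function.comp_apply, supportRow_eq]
      exact sum_mem fun k _ => Submodule.smul_mem _ _ (Submodule.subset_span ⟨k, rfl⟩))
  choose k hk using hw
  have hk0 : ∀ x, k x ≠ 0 := by
    intro x h0
    apply hwli.ne_zero x
    rw [← hk x, h0]
    exact ratioVector_zero α (a x)
  -- Outside the selected rows any nonzero index serves; it exists as `1 ≤ l i`.
  have hex : ∀ i : Fin (n + 1), ∃ k' : Fin (l i + 1), k' ≠ 0 ∧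
      ∀ x, a x = i → ratioVector α ⟨i, k'⟩ = w x := by
    intro i
    by_cases h : ∃ x, a x = i
    · obtain ⟨x, rfl⟩ := h
      refine ⟨k x, hk0 x, fun y hy => ?_⟩
      rw [ha hy]
      exact hk x
    · refine ⟨⟨1, by have := hl i; omega⟩, fun h0 => ?_, fun x hx => absurd ⟨x, hx⟩ h⟩
      simp [Fin.ext_iff] at h0
  choose k' hk'0 hk' using hex
  refine ⟨Finset.univ.image a, k', ?_, hk'0, ?_⟩
  · rw [Finset.card_image_of_injective _ ha, Finset.card_univ, fracRank_eq_finrank_span, ← hspan,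
      finrank_span_eq_card hli]
  · choose x _ hx using fun i : Finset.univ.image a => Finset.mem_image.1 i.2
    have h1 := hwli.comp x (fun i j h => Subtype.ext (by rw [← hx i, ← hx j, h]))
    have h2 : (fun i : Finset.univ.image a => ratioVector α ⟨i, k' i⟩) = w ∘ x := by
      funext i
      exact hk' i (x i) (hx i)
    rw [h2]
    exact h1

end GenericRank

/-! ### Differential transcendence degrees of generic systems -/

section Monomials

variable {υ : Type} {n : ℕ} {E : Type*} [Field E] [Algebra (LaurentDiffPoly υ (Fin n)) E]

theorem iterate_deriv_laurentVar {ι : Type} (s : υ ⊕ ι) (k : ℕ) :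
    (fun a : LaurentDiffPoly υ ι => a′)^[k] (laurentVar (s, 0)) = laurentVar (s, k) := by
  induction k with
  | zero => rfl
  | succ k ih => rw [Function.iterate_succ_apply', ih, deriv_laurentVar]

theorem iterate_deriv_algebraMap_laurentVar [Differential E]
    [DifferentialAlgebra (LaurentDiffPoly υ (Fin n)) E] (s : υ ⊕ Fin n) (k : ℕ) :
    (fun a : E => a′)^[k] (algebraMap (LaurentDiffPoly υ (Fin n)) E (laurentVar (s, 0))) =
      algebraMap (LaurentDiffPoly υ (Fin n)) E (laurentVar (s, k)) := by
  rw [← map_iterate_deriv (fun a => (deriv_algebraMap a).symm), iterate_deriv_laurentVar]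

theorem monomialUnit_nsmul {ι : Type} (N : ℕ) (β : ι × ℕ →₀ ℤ) :
    monomialUnit υ (N • β) = monomialUnit υ β ^ N := by
  induction N with
  | zero => rw [zero_smul, pow_zero]; exact Finsupp.prod_zero_index
  | succ N ih => rw [succ_nsmul, monomialUnit_add, ih, pow_succ]

/-- The exponent vectors of the Laurent differential monomials lying in a subfield. -/
def exponentSubgroup (F : Subfield E) : AddSubgroup (Fin n × ℕ →₀ ℤ) where
  carrier := {β | algebraMap (LaurentDiffPoly υ (Fin n)) E (laurentMonomial υ β) ∈ F}
  zero_mem' := by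
    have h : laurentMonomial υ (0 : Fin n × ℕ →₀ ℤ) = 1 := by
      simp [laurentMonomial]
    rw [Set.mem_ofPred_eq, h, map_one]
    exact one_mem F
  add_mem' := by
    intro a b ha hb
    rw [Set.mem_ofPred_eq, ← coe_monomialUnit, monomialUnit_add, Units.val_mul, map_mul]
    exact mul_mem ha hb
  neg_mem' := by
    intro a ha
    have h : algebraMap (LaurentDiffPoly υ (Fin n)) E (laurentMonomial υ a) *
        algebraMap (LaurentDiffPoly υ (Fin n)) E (laurentMonomial υ (-a)) = 1 := by
      rw [← map_mul, ← coe_monomialUnit, ← coe_monomialUnit, ← Units.val_mul, ← monomialUnit_add,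
        add_neg_cancel]
      simp [monomialUnit]
    rw [Set.mem_ofPred_eq, eq_inv_of_mul_eq_one_right h]
    exact inv_mem ha

theorem mem_exponentSubgroup {F : Subfield E} {β : Fin n × ℕ →₀ ℤ} :
    β ∈ exponentSubgroup (υ := υ) F ↔
      algebraMap (LaurentDiffPoly υ (Fin n)) E (laurentMonomial υ β) ∈ F := Iff.rfl

theorem single_mem_exponentSubgroup {F : Subfield E} {p : Fin n × ℕ}
    (hp : algebraMap (LaurentDiffPoly υ (Fin n)) E (laurentVar (Sum.inr p.1, p.2)) ∈ F) (e : ℤ) :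
    Finsupp.single p e ∈ exponentSubgroup (υ := υ) F := by
  have h1 : Finsupp.single p (1 : ℤ) ∈ exponentSubgroup (υ := υ) F := by
    rw [mem_exponentSubgroup, laurentMonomial, Finsupp.prod_single_index (zpow_zero _), zpow_one]
    exact hp
  rw [show Finsupp.single p e = e • Finsupp.single p (1 : ℤ) by simp]
  exact zsmul_mem h1 e

/-- Finitely many Laurent differential monomials are differentially algebraic over as many elements
as the rank of their symbolic support matrix. -/
theorem exists_monomial_generators [Differential E]
    [DifferentialAlgebra (LaurentDiffPoly υ (Fin n)) E] [CharZero E] (R : Type) [CommRing R]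
    [IsDomain R] [CharZero R] {ρ : Type} [Fintype ρ] (β : ρ → (Fin n × ℕ →₀ ℤ)) :
    ∃ (d : Type) (_ : Fintype d) (g : d → E), Fintype.card d ≤ supportRank R β ∧
      ∀ (K : Subfield E), (∀ x ∈ K, x′ ∈ K) → ∀ (d' : Type) (g' : d' → E),
        (∀ i, g i ∈ diffAlgClosure K g') → ∀ a,
          algebraMap (LaurentDiffPoly υ (Fin n)) E (laurentMonomial υ (β a)) ∈
            diffAlgClosure K g' := by
  classical
  obtain ⟨J, B, hcard, hβ⟩ := exists_monomial_basis R β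
  refine ⟨B ⊕ (Jᶜ : Finset (Fin n)), inferInstance, Sum.elim
    (fun b => algebraMap (LaurentDiffPoly υ (Fin n)) E (laurentMonomial υ (β b)))
    (fun j => algebraMap (LaurentDiffPoly υ (Fin n)) E (laurentVar (Sum.inr j, 0))), ?_, ?_⟩
  · simpa only [Fintype.card_sum, Fintype.card_coe] using hcard
  intro K hK d' g' hg a
  obtain ⟨N, hN, e, he⟩ := hβ a
  let H : AddSubgroup (Fin n × ℕ →₀ ℤ) := exponentSubgroup (υ := υ) (diffAlgClosure K g')
  have hy : ∀ p : Fin n × ℕ, p.1 ∉ J → ∀ e, Finsupp.single p e ∈ H := by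
    intro p hp e
    refine single_mem_exponentSubgroup ?_ e
    rw [← iterate_deriv_algebraMap_laurentVar]
    exact iterate_deriv_mem_diffAlgClosure hK
      (hg (Sum.inr ⟨p.1, Finset.mem_compl.2 hp⟩)) p.2
  have h1 : ∑ k : B, e k • β k ∈ H := sum_mem fun k _ => zsmul_mem
    (show β k ∈ H from hg (Sum.inl k)) _
  have h2 : N • β a - ∑ k : B, e k • β k ∈ H := by
    rw [← Finsupp.sum_single (N • β a - ∑ k : B, e k • β k)]
    refine sum_mem fun p hp => hy p (fun hpJ => ?_) _
    refine (Finsupp.mem_support_iff.1 hp) ?_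
    have := he p hpJ
    simp only [Finsupp.sub_apply, Finsupp.smul_apply, Finsupp.finsetSum_apply, nsmul_eq_mul,
      smul_eq_mul]
    rw [this, sub_self]
  have h3 : N • β a ∈ H := by
    have := add_mem h2 h1
    rwa [sub_add_cancel] at this
  rw [mem_exponentSubgroup, ← coe_monomialUnit, monomialUnit_nsmul, Units.val_pow_eq_pow_val,
    map_pow] at h3
  exact mem_diffAlgClosure_of_pow_mem hN h3

end Monomials

section Degrees

variable {n : ℕ} {l : Fin (n + 1) → ℕ} {E : Type*} [Field E] [Differential E]
  [Algebra (LaurentDiffPoly (CoeffIdx l) (Fin n)) E]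
  [DifferentialAlgebra (LaurentDiffPoly (CoeffIdx l) (Fin n)) E]

local notation "ψ" => algebraMap (LaurentDiffPoly (CoeffIdx l) (Fin n)) E

variable (α : (i : Fin (n + 1)) → Fin (l i + 1) → (Fin n × ℕ →₀ ℤ))

/-- `P_i / M_{i0}`, a Laurent differential polynomial. -/
noncomputable def normalizedLaurent (i : Fin (n + 1)) : LaurentDiffPoly (CoeffIdx l) (Fin n) :=
  ∑ k : Fin (l i + 1), coeffInclusion (CoeffIdx l) (Fin n) (MvPolynomial.X (⟨i, k⟩, 0)) *
    laurentMonomial (CoeffIdx l) (ratioExponent α ⟨i, k⟩)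

/-- The solution `u_{i0} - P_i / M_{i0}` of the equation `P_i = 0` for `u_{i0}`. -/
noncomputable def solvedCoeff (i : Fin (n + 1)) : LaurentDiffPoly (CoeffIdx l) (Fin n) :=
  ∑ k : Fin (l i + 1), coeffInclusion (CoeffIdx l) (Fin n)
    (if k = 0 then 0 else -MvPolynomial.X (⟨i, k⟩, 0)) *
      laurentMonomial (CoeffIdx l) (ratioExponent α ⟨i, k⟩)

/-- The generic zero of the elimination ideal: the leading coefficients `u_{i0}` are replaced by
the solutions of `P_i = 0`. -/
noncomputable def genericZero (c : CoeffIdx l) : LaurentDiffPoly (CoeffIdx l) (Fin n) :=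
  if c.2 = 0 then solvedCoeff α c.1 else laurentVar (Sum.inl c, 0)

/-- The field `ℚ⟨u⟩`. -/
abbrev coeffField (E : Type*) [Field E] [Differential E]
    [Algebra (LaurentDiffPoly (CoeffIdx l) (Fin n)) E] : Subfield E :=
  diffAdjoin (Set.range fun c : CoeffIdx l =>
    algebraMap (LaurentDiffPoly (CoeffIdx l) (Fin n)) E (laurentVar (Sum.inl c, 0)))

theorem coeffField_le_derivationKer {Δ : Derivation ℤ E (Fin n → Polynomial E)}
    (hΔ : IsTwistedDerivation (υ := CoeffIdx l) Δ) :
    coeffField (l := l) (n := n) E ≤ derivationKer Δ := by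
  refine Subfield.closure_le.2 ?_
  rintro _ ⟨_, ⟨c, rfl⟩, k, rfl⟩
  rw [iterate_deriv_algebraMap_laurentVar]
  exact hΔ.map_inl (c, k)

theorem diffAdjoin_empty_le (F : Subfield E) : diffAdjoin ∅ ≤ F := by
  refine Subfield.closure_le.2 ?_
  rintro _ ⟨_, h, -⟩
  exact absurd h (Set.notMem_empty _)

section Lower

variable [CharZero E] [IsFractionRing (LaurentDiffPoly (CoeffIdx l) (Fin n)) E]
  {I : Finset (Fin (n + 1))} {k : (i : Fin (n + 1)) → Fin (l i + 1)}
  {R : Type} [CommRing R] [IsDomain R]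

/-- Selected monomials with independent symbolic support vectors make the corresponding
`P_i / M_{i0}` differentially independent over `ℚ⟨u⟩`: specialize the coefficient of the selected
monomial to `1` and the other ones to `0`. -/
theorem card_le_diffTrdeg_normalized (h : LinearIndependent (FractionRing (MvPolynomial (Fin n) R))
      fun (i : I) j => algebraMap (MvPolynomial (Fin n) R) (FractionRing (MvPolynomial (Fin n) R))
        (symbolicEntry R (ratioExponent α ⟨i, k i⟩) j)) :
    (I.card : Cardinal) ≤ diffTrdeg (coeffField (l := l) (n := n) E)
      (diffAdjoin ((Set.range fun c : CoeffIdx l => ψ (laurentVar (Sum.inl c, 0))) ∪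
        Set.range fun i => ψ (normalizedLaurent α i))) := by
  classical
  rw [← Fintype.card_coe]
  refine le_diffTrdeg (b := fun i : I => ψ (normalizedLaurent α i))
    (fun i => subset_diffAdjoin _ (Or.inr ⟨i, rfl⟩)) ?_
  refine algebraicIndependent_of_symbolicEntry (τ := fun i : I => Fin (l i + 1))
    (f := fun i : I => ψ (normalizedLaurent α i))
    (fun Δ hΔ => coeffField_le_derivationKer hΔ)
    (fun i t => MvPolynomial.X (⟨i, t⟩, 0)) (fun i t => ratioExponent α ⟨i, t⟩)
    (fun i => by rw [normalizedLaurent])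
    (fun c => if c.2 = k c.1 then 1 else 0) (fun i => k i) (fun i => ?_) (fun i t ht => ?_) R h
  · simp [evalConst]
  · simp [evalConst, ht]

/-- As the leading coefficient does not occur in `u_{i0} - P_i / M_{i0}`, the selected monomials
must not be the leading ones. -/
theorem algebraicIndependent_solvedCoeff (hk : ∀ i, k i ≠ 0)
    (h : LinearIndependent (FractionRing (MvPolynomial (Fin n) R))
      fun (i : I) j => algebraMap (MvPolynomial (Fin n) R) (FractionRing (MvPolynomial (Fin n) R))
        (symbolicEntry R (ratioExponent α ⟨i, k i⟩) j)) :
    AlgebraicIndependent (coeffField (l := l) (n := n) E) fun p : I × ℕ =>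
      (fun a : E => a′)^[p.2] (ψ (solvedCoeff α p.1)) := by
  classical
  refine algebraicIndependent_of_symbolicEntry (τ := fun i : I => Fin (l i + 1))
    (f := fun i : I => ψ (solvedCoeff α i))
    (fun Δ hΔ => coeffField_le_derivationKer hΔ)
    (fun i t => if t = 0 then 0 else -MvPolynomial.X (⟨i, t⟩, 0))
    (fun i t => ratioExponent α ⟨i, t⟩) (fun i => by rw [solvedCoeff])
    (fun c => if c.2 = k c.1 then -1 else 0) (fun i => k i) (fun i => ?_) (fun i t ht => ?_) R h
  · simp [evalConst, hk]
  · by_cases h0 : t = 0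
    · simp [evalConst, h0]
    · simp [evalConst, ht, h0]

theorem card_le_diffTrdeg_ratio (h : LinearIndependent (FractionRing (MvPolynomial (Fin n) R))
      fun (i : I) j => algebraMap (MvPolynomial (Fin n) R) (FractionRing (MvPolynomial (Fin n) R))
        (symbolicEntry R (ratioExponent α ⟨i, k i⟩) j)) :
    (I.card : Cardinal) ≤ diffTrdeg (diffAdjoin (∅ : Set E)) (diffAdjoin (Set.range fun i =>
      ψ (laurentMonomial (CoeffIdx l) (ratioExponent α ⟨i, k i⟩)))) := by
  rw [← Fintype.card_coe]
  refine le_diffTrdeg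
    (b := fun i : I => ψ (laurentMonomial (CoeffIdx l) (ratioExponent α ⟨i, k i⟩)))
    (fun i => subset_diffAdjoin _ ⟨i, rfl⟩) ?_
  refine algebraicIndependent_of_symbolicEntry (υ := CoeffIdx l) (τ := fun _ : I => Unit)
    (f := fun i : I => ψ (laurentMonomial (CoeffIdx l) (ratioExponent α ⟨i, k i⟩)))
    (fun Δ _ => diffAdjoin_empty_le _) (fun _ _ => 1) (fun i _ => ratioExponent α ⟨i, k i⟩)
    (fun i => ?_) (fun _ => 0) (fun _ => ()) (fun i => map_one _) (fun i t ht => absurd rfl ht) R h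
  simp

/-- Distinct coefficients `u_{ik}` are differentially independent over `ℚ`. -/
theorem algebraicIndependent_laurentVar_inl {T : Type} {a : T → CoeffIdx l}
    (ha : Function.Injective a) :
    AlgebraicIndependent (diffAdjoin (∅ : Set E)) fun p : T × ℕ =>
      (fun a : E => a′)^[p.2] (ψ (laurentVar (Sum.inl (a p.1), 0))) := by
  obtain ⟨d, hd⟩ := exists_derivation_laurentVar (E := E) (υ := CoeffIdx l) (ι := Fin n)
    (fun p => Finsupp.single p (1 : E))
  refine algebraicIndependent_of_derivation d (diffAdjoin_empty_le _) ?_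
  have h1 := (Finsupp.linearIndependent_single_one E ((CoeffIdx l ⊕ Fin n) × ℕ)).comp
    (fun p : T × ℕ => (Sum.inl (a p.1), p.2)) (fun p q hpq => by
      simp only [Prod.mk.injEq, Sum.inl.injEq] at hpq
      exact Prod.ext (ha hpq.1) hpq.2)
  have h2 : (fun p : T × ℕ => d ((fun a : E => a′)^[p.2] (ψ (laurentVar (Sum.inl (a p.1), 0))))) =
      (fun i => Finsupp.single i (1 : E)) ∘ fun p : T × ℕ => (Sum.inl (a p.1), p.2) := by
    funext p
    simp only [iterate_deriv_algebraMap_laurentVar, hd, Function.comp_apply]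
  rw [h2]
  exact h1

end Lower

end Degrees

/-- Elements differentially independent over an intermediate field may be joined to differentially
independent elements of that field. -/
theorem algebraicIndependent_iterate_deriv_sumElim {E : Type*} [Field E] [Differential E]
    {K L : Subfield E} (hKL : K ≤ L) {S T : Type*} {x : T → E} {y : S → E}
    (hxL : ∀ p : T × ℕ, (fun a : E => a′)^[p.2] (x p.1) ∈ L)
    (hx : AlgebraicIndependent K fun p : T × ℕ => (fun a : E => a′)^[p.2] (x p.1))
    (hy : AlgebraicIndependent L fun p : S × ℕ => (fun a : E => a′)^[p.2] (y p.1)) :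
    AlgebraicIndependent K fun p : (S ⊕ T) × ℕ => (fun a : E => a′)^[p.2] (Sum.elim y x p.1) := by
  let _ : Algebra K L := (Subfield.inclusion hKL).toAlgebra
  have : IsScalarTower K L E := IsScalarTower.of_algebraMap_eq fun _ => rfl
  have hxy := hx.sumElim_of_tower (S := L) (by
    rintro _ ⟨p, rfl⟩
    exact ⟨⟨_, hxL p⟩, rfl⟩) hy
  refine (algebraicIndependent_equiv' (Equiv.sumProdDistrib S T ℕ) ?_).2 hxy
  funext p
  rcases p with ⟨i | c, k⟩ <;> rfl

section Degrees

variable {n : ℕ} {l : Fin (n + 1) → ℕ} {E : Type*} [Field E] [Differential E]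
  [Algebra (LaurentDiffPoly (CoeffIdx l) (Fin n)) E]
  [DifferentialAlgebra (LaurentDiffPoly (CoeffIdx l) (Fin n)) E]

local notation "ψ" => algebraMap (LaurentDiffPoly (CoeffIdx l) (Fin n)) E

variable (α : (i : Fin (n + 1)) → Fin (l i + 1) → (Fin n × ℕ →₀ ℤ))

variable [CharZero E]

section Lower

variable [IsFractionRing (LaurentDiffPoly (CoeffIdx l) (Fin n)) E]
  {I : Finset (Fin (n + 1))} {k : (i : Fin (n + 1)) → Fin (l i + 1)}
  {R : Type} [CommRing R] [IsDomain R]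
  
/-- The coefficients other than `u_{i0}` are independent over `ℚ`, and the selected elements
`u_{i0} - P_i / M_{i0}` over `ℚ⟨u⟩`. -/
theorem card_add_card_le_diffTrdeg_genericZero (hk : ∀ i, k i ≠ 0)
    (h : LinearIndependent (FractionRing (MvPolynomial (Fin n) R))
      fun (i : I) j => algebraMap (MvPolynomial (Fin n) R) (FractionRing (MvPolynomial (Fin n) R))
        (symbolicEntry R (ratioExponent α ⟨i, k i⟩) j)) :
    ((I.card + Fintype.card {c : CoeffIdx l // c.2 ≠ 0} : ℕ) : Cardinal) ≤
      diffTrdeg (diffAdjoin (∅ : Set E)) (diffAdjoin (Set.range fun c => ψ (genericZero α c))) := by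
  have hcard : I.card + Fintype.card {c : CoeffIdx l // c.2 ≠ 0} =
      Fintype.card (I ⊕ {c : CoeffIdx l // c.2 ≠ 0}) := by
    rw [Fintype.card_sum, Fintype.card_coe]
  rw [hcard]
  have hx := algebraicIndependent_laurentVar_inl (E := E)
    (a := fun c : {c : CoeffIdx l // c.2 ≠ 0} => c.1) Subtype.val_injective
  have hy := algebraicIndependent_solvedCoeff (E := E) α hk h
  have hxy := algebraicIndependent_iterate_deriv_sumElim
    (x := fun c : {c : CoeffIdx l // c.2 ≠ 0} => ψ (laurentVar (Sum.inl c.1, 0)))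
    (y := fun i : I => ψ (solvedCoeff α i))
    (diffAdjoin_empty_le (coeffField (l := l) (n := n) E))
    (fun p => iterate_deriv_mem_diffAdjoin (Set.mem_range_self p.1.1) p.2) hx hy
  refine le_diffTrdeg ?_ hxy
  rintro (i | c)
  · refine subset_diffAdjoin _ ⟨⟨i, 0⟩, ?_⟩
    simp [genericZero]
  · refine subset_diffAdjoin _ ⟨c, ?_⟩
    simp [genericZero, c.2]

end Lower

section Upper

/-- Up to few elements `g` and few rows, the members of a generic system are differentially
algebraic over their coefficients. -/
theorem exists_row_generators : ∃ (I : Finset (Fin (n + 1))) (d : Type) (_ : Fintype d) (g : d → E),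
    Fintype.card d + Iᶜ.card ≤ fracRank (symbolicSupportMatrix α) ∧
      ∀ (K : Subfield E), (∀ x ∈ K, x′ ∈ K) → ∀ (d' : Type) (g' : d' → E),
        (∀ i, g i ∈ diffAlgClosure K g') → ∀ i ∈ I, ∀ k,
          ψ (laurentMonomial (CoeffIdx l) (ratioExponent α ⟨i, k⟩)) ∈ diffAlgClosure K g' := by
  classical
  obtain ⟨I, hI⟩ := exists_row_bound α
  obtain ⟨d, hd, g, hcard, hg⟩ := exists_monomial_generators (E := E) (υ := CoeffIdx l)
    (DiffPoly (CoeffIdx l)) (fun c : {c : CoeffIdx l // c.1 ∈ I} => ratioExponent α c)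
  exact ⟨I, d, hd, g, by omega, fun K hK d' g' hg' i hi k => hg K hK d' g' hg' ⟨⟨i, k⟩, hi⟩⟩

theorem diffTrdeg_normalized_le :
    diffTrdeg (coeffField (l := l) (n := n) E)
      (diffAdjoin ((Set.range fun c : CoeffIdx l => ψ (laurentVar (Sum.inl c, 0))) ∪
        Set.range fun i => ψ (normalizedLaurent α i))) ≤
      (fracRank (symbolicSupportMatrix α) : Cardinal) := by
  classical
  obtain ⟨I, d, hd, g, hcard, hg⟩ := exists_row_generators (E := E) α
  let g' : d ⊕ (Iᶜ : Finset (Fin (n + 1))) → E :=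
    Sum.elim g fun i => ψ (normalizedLaurent α i)
  have hK : ∀ x ∈ coeffField (l := l) (n := n) E, x′ ∈ coeffField (l := l) (n := n) E :=
    fun x hx => deriv_mem_diffAdjoin _ hx
  have hu : ∀ c : CoeffIdx l, ψ (laurentVar (Sum.inl c, 0)) ∈
      diffAlgClosure (coeffField (l := l) (n := n) E) g' := fun c =>
    le_diffAlgClosure g' (subset_diffAdjoin _ ⟨c, rfl⟩)
  refine (diffTrdeg_le hK g' (diffAdjoin_le_diffAlgClosure hK ?_)).trans ?_
  · rintro _ (⟨c, rfl⟩ | ⟨i, rfl⟩)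
    · exact hu c
    · by_cases hi : i ∈ I
      · have h1 := hg _ hK _ g' (fun i => mem_diffAlgClosure_self g' (Sum.inl i)) i hi
        simp only [normalizedLaurent, map_sum, map_mul, coeffInclusion_X]
        exact sum_mem fun k _ => mul_mem (hu _) (h1 k)
      · exact mem_diffAlgClosure_self g' (Sum.inr ⟨i, Finset.mem_compl.2 hi⟩)
  · rw [Fintype.card_sum, Fintype.card_coe]
    exact_mod_cast hcard

theorem diffTrdeg_genericZero_le :
    diffTrdeg (diffAdjoin (∅ : Set E)) (diffAdjoin (Set.range fun c => ψ (genericZero α c))) ≤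
      ((fracRank (symbolicSupportMatrix α) + Fintype.card {c : CoeffIdx l // c.2 ≠ 0} : ℕ) :
        Cardinal) := by
  classical
  obtain ⟨I, d, hd, g, hcard, hg⟩ := exists_row_generators (E := E) α
  let g' : (d ⊕ (Iᶜ : Finset (Fin (n + 1)))) ⊕ {c : CoeffIdx l // c.2 ≠ 0} → E :=
    Sum.elim (Sum.elim g fun i => ψ (solvedCoeff α i)) fun c => ψ (laurentVar (Sum.inl c.1, 0))
  have hK : ∀ x ∈ diffAdjoin (∅ : Set E), x′ ∈ diffAdjoin (∅ : Set E) :=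
    fun x hx => deriv_mem_diffAdjoin _ hx
  have hu : ∀ c : CoeffIdx l, c.2 ≠ 0 → ψ (laurentVar (Sum.inl c, 0)) ∈
      diffAlgClosure (diffAdjoin (∅ : Set E)) g' := fun c hc =>
    mem_diffAlgClosure_self g' (Sum.inr ⟨c, hc⟩)
  refine (diffTrdeg_le hK g' (diffAdjoin_le_diffAlgClosure hK ?_)).trans ?_
  · rintro _ ⟨⟨i, k⟩, rfl⟩
    by_cases hk : k = 0
    · subst hk
      simp only [genericZero, if_pos]
      by_cases hi : i ∈ I
      · have h1 := hg _ hK _ g' (fun i => mem_diffAlgClosure_self g' (Sum.inl (Sum.inl i))) i hi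
        simp only [solvedCoeff, map_sum, map_mul]
        refine sum_mem fun k _ => mul_mem ?_ (h1 k)
        by_cases hk : k = 0
        · rw [if_pos hk, map_zero, map_zero]
          exact zero_mem _
        · rw [if_neg hk, map_neg, map_neg, coeffInclusion_X]
          exact neg_mem (hu ⟨i, k⟩ hk)
      · exact mem_diffAlgClosure_self g' (Sum.inl (Sum.inr ⟨i, Finset.mem_compl.2 hi⟩))
    · simp only [genericZero, if_neg hk]
      exact hu ⟨i, k⟩ hk
  · rw [Fintype.card_sum, Fintype.card_sum, Fintype.card_coe]
    exact_mod_cast Nat.add_le_add_right hcard _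

theorem diffTrdeg_ratio_le (k : (i : Fin (n + 1)) → Fin (l i + 1)) :
    diffTrdeg (diffAdjoin (∅ : Set E)) (diffAdjoin (Set.range fun i =>
      ψ (laurentMonomial (CoeffIdx l) (ratioExponent α ⟨i, k i⟩)))) ≤
      (supportRank ℤ (fun i => ratioExponent α ⟨i, k i⟩) : Cardinal) := by
  obtain ⟨d, hd, g, hcard, hg⟩ := exists_monomial_generators (E := E) (υ := CoeffIdx l) ℤ
    (fun i => ratioExponent α ⟨i, k i⟩)
  have hK : ∀ x ∈ diffAdjoin (∅ : Set E), x′ ∈ diffAdjoin (∅ : Set E) :=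
    fun x hx => deriv_mem_diffAdjoin _ hx
  refine (diffTrdeg_le hK g (diffAdjoin_le_diffAlgClosure hK ?_)).trans
    (Nat.cast_le.2 hcard)
  rintro _ ⟨i, rfl⟩
  exact hg _ hK _ g (mem_diffAlgClosure_self g) i

end Upper

section Equalities

variable [IsFractionRing (LaurentDiffPoly (CoeffIdx l) (Fin n)) E]

theorem diffTrdeg_normalized_eq (hl : ∀ i, 1 ≤ l i) :
    diffTrdeg (coeffField (l := l) (n := n) E)
      (diffAdjoin ((Set.range fun c : CoeffIdx l => ψ (laurentVar (Sum.inl c, 0))) ∪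
        Set.range fun i => ψ (normalizedLaurent α i))) =
      (fracRank (symbolicSupportMatrix α) : Cardinal) := by
  obtain ⟨I, k, hI, hk, h⟩ := exists_selection α hl
  refine le_antisymm (diffTrdeg_normalized_le α) ?_
  rw [← hI]
  exact card_le_diffTrdeg_normalized α h

theorem diffTrdeg_genericZero_eq (hl : ∀ i, 1 ≤ l i) :
    diffTrdeg (diffAdjoin (∅ : Set E)) (diffAdjoin (Set.range fun c => ψ (genericZero α c))) =
      ((fracRank (symbolicSupportMatrix α) + Fintype.card {c : CoeffIdx l // c.2 ≠ 0} : ℕ) :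
        Cardinal) := by
  obtain ⟨I, k, hI, hk, h⟩ := exists_selection α hl
  refine le_antisymm (diffTrdeg_genericZero_le α) ?_
  rw [← hI]
  exact card_add_card_le_diffTrdeg_genericZero α hk h

theorem diffTrdeg_ratio_eq (k : (i : Fin (n + 1)) → Fin (l i + 1)) :
    diffTrdeg (diffAdjoin (∅ : Set E)) (diffAdjoin (Set.range fun i =>
      ψ (laurentMonomial (CoeffIdx l) (ratioExponent α ⟨i, k i⟩)))) =
      (supportRank ℤ (fun i => ratioExponent α ⟨i, k i⟩) : Cardinal) := by
  refine le_antisymm (diffTrdeg_ratio_le α k) ?_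
  rw [supportRank, Matrix.rank_eq_finrank_span_row]
  obtain ⟨I, hI, h⟩ := exists_finset_linearIndependent
    (Ω := FractionRing (MvPolynomial (Fin n) ℤ)) (Matrix.row (Matrix.of fun (i : Fin (n + 1)) j =>
      algebraMap (MvPolynomial (Fin n) ℤ) (FractionRing (MvPolynomial (Fin n) ℤ))
        (symbolicEntry ℤ (ratioExponent α ⟨i, k i⟩) j)))
  rw [← hI]
  exact card_le_diffTrdeg_ratio α h

end Equalities

end Degrees

/-! ### Generic zeros of prime differential ideals -/

section GenericZero

variable {F E : Type*} [Field F] [Field E] [Differential F] [Differential E] {j : F →+* E}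

theorem map_diffAdjoin (hj : ∀ a, j a′ = (j a)′) (S : Set F) :
    (diffAdjoin S).map j = diffAdjoin (j '' S) := by
  rw [diffAdjoin, RingHom.map_field_closure, diffAdjoin]
  congr 1
  ext x
  constructor
  · rintro ⟨_, ⟨s, hs, k, rfl⟩, rfl⟩
    exact ⟨j s, ⟨s, hs, rfl⟩, k, map_iterate_deriv hj s k⟩
  · rintro ⟨_, ⟨s, hs, rfl⟩, k, rfl⟩
    exact ⟨_, ⟨s, hs, k, rfl⟩, map_iterate_deriv hj s k⟩

theorem diffIndep_map_image_iff (hj : ∀ a, j a′ = (j a)′) (K : Subfield F) (s : Set F) :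
    DiffIndep (K.map j) (j '' s) ↔ DiffIndep K s := by
  let f : K →+* K.map j := j.restrict K (K.map j) fun x hx => ⟨x, hx, rfl⟩
  have hf : Function.Bijective f := by
    refine ⟨f.injective, ?_⟩
    rintro ⟨_, x, hx, rfl⟩
    exact ⟨⟨x, hx⟩, rfl⟩
  let e : K ≃+* K.map j := RingEquiv.ofBijective f hf
  have h1 := algebraicIndependent_ringHom_iff_of_comp_eq e j
    (x := fun p : s × ℕ => (fun a : F => a′)^[p.2] (p.1 : F)) j.injective (by
      ext x
      rfl)
  rw [DiffIndep, DiffIndep, ← h1]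
  let e' := (Equiv.Set.image j s j.injective).prodCongr (Equiv.refl ℕ)
  refine (algebraicIndependent_equiv' e' ?_).symm
  funext p
  exact (map_iterate_deriv hj _ _).symm

end GenericZero

/-- The differential transcendence degree is invariant under differential embeddings. -/
theorem diffTrdeg_map {F E : Type} [Field F] [Field E] [Differential F] [Differential E]
    {j : F →+* E} (hj : ∀ a, j a′ = (j a)′) (K L : Subfield F) :
    diffTrdeg (K.map j) (L.map j) = diffTrdeg K L := by
  symm
  refine Function.Surjective.iSup_congr
    (fun s : {s : Set F // s ⊆ L ∧ DiffIndep K s} =>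
      (⟨j '' s.1, by
        rintro _ ⟨x, hx, rfl⟩
        exact ⟨x, s.2.1 hx, rfl⟩, (diffIndep_map_image_iff hj K s.1).2 s.2.2⟩ :
      {t : Set E // t ⊆ L.map j ∧ DiffIndep (K.map j) t})) ?_
    fun s => Cardinal.mk_image_eq j.injective
  rintro ⟨t, htL, ht⟩
  have himg : j '' (j ⁻¹' t) = t := Set.image_preimage_eq_of_subset (by
    intro x hx
    obtain ⟨y, -, rfl⟩ := htL hx
    exact ⟨y, rfl⟩)
  refine ⟨⟨j ⁻¹' t, ?_, ?_⟩, Subtype.ext himg⟩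
  · intro x hx
    obtain ⟨y, hy, hyx⟩ := htL hx
    rwa [← j.injective hyx]
  · rw [← diffIndep_map_image_iff hj, himg]
    exact ht

theorem isPrimeDiffIdeal_ker {A B : Type*} [CommRing A] [CommRing B] [IsDomain B] [Differential A]
    [Differential B] {f : A →+* B} (hf : ∀ a, f a′ = (f a)′) : IsPrimeDiffIdeal (RingHom.ker f) :=
  ⟨RingHom.ker_isPrime f, fun a ha => by
    rw [RingHom.mem_ker] at ha ⊢
    rw [hf, ha, map_zero]⟩

/-- The dimension of a prime differential ideal, computed from any of its generic zeros. -/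
theorem diffDim_ker {σ E : Type} [Field E] [Differential E] {f : DiffPoly σ →+* E}
    (hf : ∀ a, f a′ = (f a)′) {I : Ideal (DiffPoly σ)} (hI : I = RingHom.ker f)
    (h : IsPrimeDiffIdeal I) : diffDim I h =
      diffTrdeg (diffAdjoin (∅ : Set E))
        (diffAdjoin (Set.range fun s => f (MvPolynomial.X (s, 0)))) := by
  subst hI
  have : (RingHom.ker f).IsPrime := h.isPrime
  let _ : Differential (DiffPoly σ ⧸ RingHom.ker f) := quotientDifferential _ h.isDiffIdeal
  let f' : DiffPoly σ ⧸ RingHom.ker f →+* E := RingHom.kerLift f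
  have hf' : ∀ a, f' a′ = (f' a)′ := by
    intro a
    obtain ⟨a, rfl⟩ := Ideal.Quotient.mk_surjective a
    have h1 : (Ideal.Quotient.mk (RingHom.ker f) a)′ = Ideal.Quotient.mk (RingHom.ker f) a′ :=
      Derivation.liftOfSurjective_apply _ _ _
    rw [h1]
    exact hf a
  have hinj : Function.Injective f' := RingHom.kerLift_injective f
  let j : FractionRing (DiffPoly σ ⧸ RingHom.ker f) →+* E := IsFractionRing.lift hinj
  have hjf : ∀ a, j (algebraMap _ _ (Ideal.Quotient.mk _ a)) = f a := fun a =>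
    IsFractionRing.lift_algebraMap hinj _
  have hj : ∀ a, j a′ = (j a)′ := by
    refine localization_map_deriv _ _ fun a => ?_
    rw [IsFractionRing.lift_algebraMap, IsFractionRing.lift_algebraMap]
    exact hf' a
  have hX : ∀ s k, f (MvPolynomial.X (s, k)) =
      (fun a : E => a′)^[k] (f (MvPolynomial.X (s, 0))) := by
    intro s k
    rw [← map_iterate_deriv hf, iterate_deriv_diffPoly_X]
  have hrange : (⊤ : Subfield (FractionRing (DiffPoly σ ⧸ RingHom.ker f))).map j =
      diffAdjoin (Set.range fun s => f (MvPolynomial.X (s, 0))) := by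
    refine le_antisymm ?_ (Subfield.closure_le.2 ?_)
    · rintro _ ⟨x, -, rfl⟩
      obtain ⟨a, b, -, rfl⟩ := IsFractionRing.div_surjective
        (A := DiffPoly σ ⧸ RingHom.ker f) x
      obtain ⟨a, rfl⟩ := Ideal.Quotient.mk_surjective a
      obtain ⟨b, rfl⟩ := Ideal.Quotient.mk_surjective b
      have hmem : ∀ a, f a ∈ diffAdjoin (Set.range fun s => f (MvPolynomial.X (s, 0))) := by
        intro a
        induction a using MvPolynomial.induction_on with
        | C r =>
          have h2 : (f.comp MvPolynomial.C) r = (r : E) := map_ratCast _ r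
          rw [RingHom.comp_apply] at h2
          rw [h2]
          exact SubfieldClass.ratCast_mem _ r
        | add p q hp hq =>
          rw [map_add]
          exact add_mem hp hq
        | mul_X p i hp =>
          rw [map_mul, hX i.1 i.2]
          exact mul_mem hp (iterate_deriv_mem_diffAdjoin (Set.mem_range_self i.1) _)
      rw [map_div₀, hjf, hjf]
      exact div_mem (hmem a) (hmem b)
    · rintro _ ⟨_, ⟨s, rfl⟩, k, rfl⟩
      rw [← hX, ← hjf]
      exact ⟨_, trivial, rfl⟩
  have h1 := diffTrdeg_map hj (diffAdjoin ∅) ⊤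
  rw [map_diffAdjoin hj, Set.image_empty, hrange] at h1
  exact h1.symm

/-! ### The elimination ideal -/

section Elimination

variable {n : ℕ} {l : Fin (n + 1) → ℕ}
  (α : (i : Fin (n + 1)) → Fin (l i + 1) → (Fin n × ℕ →₀ ℤ))

theorem genericLaurent_eq (i : Fin (n + 1)) : genericLaurent α i =
    normalizedLaurent α i * laurentMonomial (CoeffIdx l) (α i 0) := by
  rw [genericLaurent, normalizedLaurent, Finset.sum_mul]
  refine Finset.sum_congr rfl fun k _ => ?_
  rw [mul_assoc, ← coe_monomialUnit, ← coe_monomialUnit, ← coe_monomialUnit, ← Units.val_mul,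
    ← monomialUnit_add, sub_add_cancel]

theorem normalizedLaurent_eq (i : Fin (n + 1)) :
    normalizedLaurent α i = laurentVar (Sum.inl ⟨i, 0⟩, 0) - solvedCoeff α i := by
  rw [eq_sub_iff_add_eq, normalizedLaurent, solvedCoeff, ← Finset.sum_add_distrib,
    Finset.sum_eq_single 0]
  · rw [coeffInclusion_X, if_pos rfl, map_zero, zero_mul, add_zero, ratioExponent, sub_self]
    simp [laurentMonomial]
  · intro k _ hk
    rw [if_neg hk, ← add_mul, ← map_add, add_neg_cancel, map_zero, zero_mul]
  · exact fun h => absurd (Finset.mem_univ _) h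

/-- Substituting the solutions of `P_i = 0` for `u_{i0}`. -/
theorem exists_substitution : ∃ f : LaurentDiffPoly (CoeffIdx l) (Fin n) →+*
    LaurentDiffPoly (CoeffIdx l) (Fin n), (∀ a, f a′ = (f a)′) ∧
      (∀ c k, f (laurentVar (Sum.inl c, k)) = (fun a => a′)^[k] (genericZero α c)) ∧
      ∀ j k, f (laurentVar (Sum.inr j, k)) = laurentVar (Sum.inr j, k) := by
  let v : (CoeffIdx l ⊕ Fin n) × ℕ → LaurentDiffPoly (CoeffIdx l) (Fin n) := fun p =>
    match p.1 with
    | Sum.inl c => (fun a => a′)^[p.2] (genericZero α c)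
    | Sum.inr j => laurentVar (Sum.inr j, p.2)
  have hv : ∀ p, v (p.1, p.2 + 1) = (v p)′ := by
    rintro ⟨c | j, k⟩
    · simp only [v, Function.iterate_succ_apply']
    · simp only [v, deriv_laurentVar]
  have hvu : ∀ p : Fin n × ℕ, IsUnit (v (Sum.inr p.1, p.2)) := fun p => by
    simp only [v]
    rw [← coe_yUnit]
    exact Units.isUnit _
  obtain ⟨f, hf, hfv⟩ := exists_laurentHom v hv hvu
  exact ⟨f, hf, fun c k => hfv _, fun j k => hfv _⟩

variable {α} {f : LaurentDiffPoly (CoeffIdx l) (Fin n) →+* LaurentDiffPoly (CoeffIdx l) (Fin n)}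

theorem map_laurentMonomial_of_fixed
    (hy : ∀ j k, f (laurentVar (Sum.inr j, k)) = laurentVar (Sum.inr j, k))
    (β : Fin n × ℕ →₀ ℤ) :
    f (laurentMonomial (CoeffIdx l) β) = laurentMonomial (CoeffIdx l) β := by
  have hu : ∀ p : Fin n × ℕ, Units.map (f : _ →* LaurentDiffPoly (CoeffIdx l) (Fin n))
      (yUnit (CoeffIdx l) p) = yUnit (CoeffIdx l) p := fun p => Units.ext (hy p.1 p.2)
  have h1 : Units.map (f : _ →* LaurentDiffPoly (CoeffIdx l) (Fin n))
      (monomialUnit (CoeffIdx l) β) = monomialUnit (CoeffIdx l) β := by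
    rw [monomialUnit, map_finsuppProd]
    refine Finset.prod_congr rfl fun p _ => ?_
    simp only [map_zpow, hu]
  exact congrArg Units.val h1

theorem map_normalizedLaurent_eq_zero
    (hu : ∀ c k, f (laurentVar (Sum.inl c, k)) = (fun a => a′)^[k] (genericZero α c))
    (hy : ∀ j k, f (laurentVar (Sum.inr j, k)) = laurentVar (Sum.inr j, k)) (i : Fin (n + 1)) :
    f (normalizedLaurent α i) = 0 := by
  have h1 : f (solvedCoeff α i) = solvedCoeff α i := by
    rw [solvedCoeff, map_sum]
    refine Finset.sum_congr rfl fun k _ => ?_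
    rw [map_mul, map_laurentMonomial_of_fixed hy]
    by_cases hk : k = 0
    · rw [if_pos hk, map_zero, map_zero]
    · rw [if_neg hk, map_neg, map_neg, coeffInclusion_X, hu, genericZero, if_neg hk]
      rfl
  rw [normalizedLaurent_eq, map_sub, h1, hu, Function.iterate_zero, id, genericZero, if_pos rfl,
    sub_self]

/-- The differential ideal generated by a generic system is the kernel of the substitution of its
solutions: modulo the ideal, the substitution does not change any indeterminate. -/
theorem diffSpan_genericLaurent_eq_ker (hf : ∀ a, f a′ = (f a)′)
    (hu : ∀ c k, f (laurentVar (Sum.inl c, k)) = (fun a => a′)^[k] (genericZero α c))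
    (hy : ∀ j k, f (laurentVar (Sum.inr j, k)) = laurentVar (Sum.inr j, k)) :
    diffSpan (Set.range (genericLaurent α)) = RingHom.ker f := by
  refine le_antisymm (sInf_le ⟨?_, (isPrimeDiffIdeal_ker hf).isDiffIdeal⟩)
    (le_sInf fun I hI a ha => ?_)
  · rintro _ ⟨i, rfl⟩
    rw [SetLike.mem_coe, RingHom.mem_ker, genericLaurent_eq, map_mul,
      map_normalizedLaurent_eq_zero hu hy, zero_mul]
  · obtain ⟨hP, hId⟩ := hI
    have hN : ∀ i, normalizedLaurent α i ∈ I := by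
      intro i
      have h1 := hP ⟨i, rfl⟩
      rw [SetLike.mem_coe, genericLaurent_eq, ← coe_monomialUnit] at h1
      exact (I.mul_unit_mem_iff_mem (monomialUnit _ (α i 0)).isUnit).1 h1
    have hu0 : ∀ c, laurentVar (Sum.inl c, 0) - genericZero α c ∈ I := by
      rintro ⟨i, k⟩
      by_cases hk : k = 0
      · subst hk
        rw [genericZero, if_pos rfl, ← normalizedLaurent_eq]
        exact hN i
      · rw [genericZero, if_neg hk, sub_self]
        exact I.zero_mem
    have hD : ∀ (k : ℕ) (x y : LaurentDiffPoly (CoeffIdx l) (Fin n)), x - y ∈ I →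
        (fun a => a′)^[k] x - (fun a => a′)^[k] y ∈ I := by
      intro k
      induction k with
      | zero => exact fun x y h => h
      | succ k ih =>
        intro x y h
        rw [Function.iterate_succ_apply', Function.iterate_succ_apply', ← map_sub]
        exact hId _ (ih x y h)
    have hmk : (Ideal.Quotient.mk I).comp f = Ideal.Quotient.mk I := by
      refine laurentHom_ext ?_
      rintro ⟨c | j, k⟩
      · rw [RingHom.comp_apply, hu, ← iterate_deriv_laurentVar]
        exact (Ideal.Quotient.eq.2 (hD k _ _ (hu0 c))).symm
      · rw [RingHom.comp_apply, hy]
    have h2 := congrArg (fun g => g a) hmk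
    simp only [RingHom.comp_apply] at h2
    rw [RingHom.mem_ker.1 ha, map_zero] at h2
    exact Ideal.Quotient.eq_zero_iff_mem.1 h2.symm

/-- The elimination ideal is a prime differential ideal, of which `genericZero` is a generic
zero. -/
theorem exists_eliminationIdeal_eq_ker {E : Type*} [Field E] [Differential E]
    [Algebra (LaurentDiffPoly (CoeffIdx l) (Fin n)) E]
    [IsFractionRing (LaurentDiffPoly (CoeffIdx l) (Fin n)) E]
    [DifferentialAlgebra (LaurentDiffPoly (CoeffIdx l) (Fin n)) E]
    (α : (i : Fin (n + 1)) → Fin (l i + 1) → (Fin n × ℕ →₀ ℤ)) :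
    ∃ g : DiffPoly (CoeffIdx l) →+* E, (∀ a, g a′ = (g a)′) ∧
      (∀ c, g (MvPolynomial.X (c, 0)) =
        algebraMap (LaurentDiffPoly (CoeffIdx l) (Fin n)) E (genericZero α c)) ∧
      eliminationIdeal α = RingHom.ker g := by
  obtain ⟨f, hf, hu, hy⟩ := exists_substitution α
  refine ⟨(algebraMap (LaurentDiffPoly (CoeffIdx l) (Fin n)) E).comp
    (f.comp (coeffInclusion (CoeffIdx l) (Fin n))), fun a => ?_, fun c => ?_, ?_⟩
  · rw [RingHom.comp_apply, RingHom.comp_apply, coeffInclusion_deriv, hf, ← deriv_algebraMap]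
    rfl
  · rw [RingHom.comp_apply, RingHom.comp_apply, coeffInclusion_X, hu]
    rfl
  · ext a
    rw [eliminationIdeal, Ideal.mem_comap, diffSpan_genericLaurent_eq_ker hf hu hy,
      RingHom.mem_ker, RingHom.mem_ker, RingHom.comp_apply, RingHom.comp_apply,
      map_eq_zero_iff _ (toField_injective (E := E))]

end Elimination

/-! ### Generic systems in the field of fractions -/

section Main

instance instDifferentialAlgebraLaurentField (υ ι : Type) :
    DifferentialAlgebra (LaurentDiffPoly υ ι) (LaurentField υ ι) :=
  ⟨algebraMap_deriv_localization _⟩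

instance instCharZeroLaurentField (υ ι : Type) : CharZero (LaurentField υ ι) :=
  have : Function.Injective (algebraMap (DiffPoly (υ ⊕ ι)) (LaurentDiffPoly υ ι)) :=
    IsLocalization.injective _ (yMonomials_le υ ι)
  have : CharZero (LaurentDiffPoly υ ι) := charZero_of_injective_algebraMap this
  charZero_of_injective_algebraMap (IsFractionRing.injective (LaurentDiffPoly υ ι) _)

variable {n : ℕ} {l : Fin (n + 1) → ℕ}
  (α : (i : Fin (n + 1)) → Fin (l i + 1) → (Fin n × ℕ →₀ ℤ))

theorem coeffSet_eq (l : Fin (n + 1) → ℕ) : coeffSet l = Set.range fun c : CoeffIdx l =>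
    algebraMap (LaurentDiffPoly (CoeffIdx l) (Fin n)) (LaurentField (CoeffIdx l) (Fin n))
      (laurentVar (Sum.inl c, 0)) := by
  simp only [coeffSet, coeffInclusion_X]

theorem algebraMap_laurentMonomial_ne_zero (β : Fin n × ℕ →₀ ℤ) :
    algebraMap (LaurentDiffPoly (CoeffIdx l) (Fin n)) (LaurentField (CoeffIdx l) (Fin n))
      (laurentMonomial (CoeffIdx l) β) ≠ 0 :=
  ((monomialUnit (CoeffIdx l) β).isUnit.map _).ne_zero

theorem normalizedSet_eq : normalizedSet α = Set.range fun i =>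
    algebraMap (LaurentDiffPoly (CoeffIdx l) (Fin n)) (LaurentField (CoeffIdx l) (Fin n))
      (normalizedLaurent α i) := by
  rw [normalizedSet]
  congr 1
  funext i
  rw [genericLaurent_eq, map_mul]
  exact mul_div_cancel_right₀ _ (algebraMap_laurentMonomial_ne_zero _)

theorem monomialRatioSet_eq (k : (i : Fin (n + 1)) → Fin (l i + 1)) :
    monomialRatioSet α k = Set.range fun i =>
      algebraMap (LaurentDiffPoly (CoeffIdx l) (Fin n)) (LaurentField (CoeffIdx l) (Fin n))
        (laurentMonomial (CoeffIdx l) (ratioExponent α ⟨i, k i⟩)) := by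
  rw [monomialRatioSet]
  congr 1
  funext i
  rw [div_eq_iff (algebraMap_laurentMonomial_ne_zero _), ← map_mul]
  simp only [← coe_monomialUnit]
  rw [← Units.val_mul, ← monomialUnit_add, sub_add_cancel]

theorem supportRank_eq_fracRank (k : (i : Fin (n + 1)) → Fin (l i + 1)) :
    supportRank ℤ (fun i => ratioExponent α ⟨i, k i⟩) =
      fracRank (monomialSupportMatrix fun i => α i (k i) - α i 0) := rfl

theorem diffTrdeg_monomialRatioSet (k : (i : Fin (n + 1)) → Fin (l i + 1)) :
    diffTrdeg (diffAdjoin ∅) (diffAdjoin (monomialRatioSet α k)) =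
      (fracRank (monomialSupportMatrix fun i => α i (k i) - α i 0) : Cardinal) := by
  rw [monomialRatioSet_eq, diffTrdeg_ratio_eq, supportRank_eq_fracRank]

theorem diffTrdeg_normalizedSet (hl : ∀ i, 1 ≤ l i) :
    diffTrdeg (diffAdjoin (coeffSet l)) (diffAdjoin (coeffSet l ∪ normalizedSet α)) =
      (fracRank (symbolicSupportMatrix α) : Cardinal) := by
  rw [coeffSet_eq, normalizedSet_eq]
  exact diffTrdeg_normalized_eq α hl

theorem fracRank_le_width {R : Type} [CommRing R] [IsDomain R] {m n : ℕ}
    (A : Matrix (Fin m) (Fin n) R) : fracRank A ≤ n :=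
  Matrix.rank_le_width _

/-- Selections of monomials have symbolic support matrices of rank at most that of the system. -/
theorem fracRank_monomialSupportMatrix_le (k : (i : Fin (n + 1)) → Fin (l i + 1)) :
    fracRank (monomialSupportMatrix fun i => α i (k i) - α i 0) ≤
      fracRank (symbolicSupportMatrix α) := by
  obtain ⟨I, hI, h⟩ := exists_finset_linearIndependent
    (Ω := FractionRing (MvPolynomial (Fin n) ℤ)) (Matrix.row (Matrix.of fun (i : Fin (n + 1)) j =>
      algebraMap (MvPolynomial (Fin n) ℤ) (FractionRing (MvPolynomial (Fin n) ℤ))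
        (symbolicEntry ℤ (ratioExponent α ⟨i, k i⟩) j)))
  rw [← supportRank_eq_fracRank, supportRank, Matrix.rank_eq_finrank_span_row, ← hI]
  have h1 := (card_le_diffTrdeg_normalized (E := LaurentField (CoeffIdx l) (Fin n)) α h).trans
    (diffTrdeg_normalized_le α)
  exact_mod_cast h1

/-- A suitable selection of monomials attains the rank of the system. -/
theorem exists_fracRank_le_monomialSupportMatrix (hl : ∀ i, 1 ≤ l i) :
    ∃ k : (i : Fin (n + 1)) → Fin (l i + 1), (∀ i, k i ≠ 0) ∧
      fracRank (symbolicSupportMatrix α) ≤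
        fracRank (monomialSupportMatrix fun i => α i (k i) - α i 0) := by
  obtain ⟨I, k, hI, hk, h⟩ := exists_selection α hl
  refine ⟨k, hk, ?_⟩
  have h1 := (card_le_diffTrdeg_ratio (E := LaurentField (CoeffIdx l) (Fin n)) α h).trans
    (diffTrdeg_ratio_le α k)
  rw [hI, supportRank_eq_fracRank] at h1
  exact_mod_cast h1

theorem card_coeffIdx (l : Fin (n + 1) → ℕ) :
    Fintype.card (CoeffIdx l) = Fintype.card {c : CoeffIdx l // c.2 ≠ 0} + (n + 1) := by
  have h1 : Fintype.card {c : CoeffIdx l // c.2 = 0} = n + 1 := by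
    refine (Fintype.card_congr ⟨fun c => c.1.1, fun i => ⟨⟨i, 0⟩, rfl⟩, ?_, fun i => rfl⟩).trans
      (Fintype.card_fin (n + 1))
    rintro ⟨⟨i, k⟩, hk⟩
    exact Subtype.ext (Sigma.ext rfl (heq_of_eq hk.symm))
  have h2 := Fintype.card_subtype_compl fun c : CoeffIdx l => c.2 = 0
  have h3 := Fintype.card_subtype_le fun c : CoeffIdx l => c.2 = 0
  rw [h1] at h2 h3
  have h4 : Fintype.card {c : CoeffIdx l // c.2 ≠ 0} = Fintype.card {c : CoeffIdx l // ¬ c.2 = 0} :=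
    rfl
  omega

/-- The codimension of the elimination ideal: of the `card {c // c.2 ≠ 0} + (n + 1)` indeterminates,
`card {c // c.2 ≠ 0} + rank M_P` count for the dimension. -/
theorem isPrimeDiffIdealOfCodim_eliminationIdeal_iff (hl : ∀ i, 1 ≤ l i) (c : ℕ) :
    IsPrimeDiffIdealOfCodim (eliminationIdeal α) c ↔
      fracRank (symbolicSupportMatrix α) + c = n + 1 := by
  obtain ⟨g, hg, hgX, hI⟩ := exists_eliminationIdeal_eq_ker
    (E := LaurentField (CoeffIdx l) (Fin n)) α
  have hprime : IsPrimeDiffIdeal (eliminationIdeal α) := hI ▸ isPrimeDiffIdeal_ker hg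
  have hdim : ∀ h, diffDim (eliminationIdeal α) h = ((fracRank (symbolicSupportMatrix α) +
      Fintype.card {c : CoeffIdx l // c.2 ≠ 0} : ℕ) : Cardinal) := by
    intro h
    rw [diffDim_ker hg hI h]
    simp only [hgX]
    exact diffTrdeg_genericZero_eq α hl
  have hcard := card_coeffIdx l
  constructor
  · rintro ⟨h, hc⟩
    rw [hdim] at hc
    have h1 : fracRank (symbolicSupportMatrix α) + Fintype.card {c : CoeffIdx l // c.2 ≠ 0} + c =
        Fintype.card (CoeffIdx l) := by exact_mod_cast hc
    omega
  · intro hc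
    refine ⟨hprime, ?_⟩
    rw [hdim]
    have h1 : fracRank (symbolicSupportMatrix α) + Fintype.card {c : CoeffIdx l // c.2 ≠ 0} + c =
        Fintype.card (CoeffIdx l) := by omega
    exact_mod_cast h1

end Main

theorem mainTheorem1 (n : ℕ) (l : Fin (n + 1) → ℕ) (hl : ∀ i, 1 ≤ l i)
    (α : (i : Fin (n + 1)) → Fin (l i + 1) → (Fin n × ℕ →₀ ℤ))
    (hα : ∀ i, Function.Injective (α i)) :
    diffTrdeg (diffAdjoin (coeffSet l)) (diffAdjoin (coeffSet l ∪ normalizedSet α)) =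
        (fracRank (symbolicSupportMatrix α) : Cardinal) ∧
      IsPrimeDiffIdealOfCodim (eliminationIdeal α)
        (n + 1 - fracRank (symbolicSupportMatrix α)) ∧
      (IsLaurentDiffEssential α ↔ fracRank (symbolicSupportMatrix α) = n) ∧
      (IsLaurentDiffEssential α ↔
        ∃ k : (i : Fin (n + 1)) → Fin (l i + 1), (∀ i, k i ≠ 0) ∧
          fracRank (monomialSupportMatrix fun i => α i (k i) - α i 0) = n) ∧
      (IsLaurentDiffEssential α ↔ IsLaurentDiffEssentialMonomials α) := by
  have hn := fracRank_le_width (symbolicSupportMatrix α)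
  have hess : IsLaurentDiffEssential α ↔ fracRank (symbolicSupportMatrix α) = n :=
    (isPrimeDiffIdealOfCodim_eliminationIdeal_iff α hl 1).trans (by omega)
  have hsel : IsLaurentDiffEssential α ↔
      ∃ k : (i : Fin (n + 1)) → Fin (l i + 1), (∀ i, k i ≠ 0) ∧
        fracRank (monomialSupportMatrix fun i => α i (k i) - α i 0) = n := by
    rw [hess]
    constructor
    · intro h
      obtain ⟨k, hk, hle⟩ := exists_fracRank_le_monomialSupportMatrix α hl
      exact ⟨k, hk, le_antisymm (fracRank_le_width _) (h.ge.trans hle)⟩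
    · rintro ⟨k, -, hk⟩
      have h1 := fracRank_monomialSupportMatrix_le α k
      omega
  refine ⟨diffTrdeg_normalizedSet α hl,
    (isPrimeDiffIdealOfCodim_eliminationIdeal_iff α hl _).2 (by omega), hess, hsel, ?_⟩
  simp only [hsel, IsLaurentDiffEssentialMonomials, diffTrdeg_monomialRatioSet, Nat.cast_inj]
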